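/- **Theorem.** For every dimension $d$ there is a constant $\beta_d>0$, depending only on $d$, and for every integer $k\ge 2$ there is a constant $C_{k,d}>0$, depending only on $k$ and $d$, such that the following holds. For a $C^k$ function $g$ on $S$ put $\|g\|_{C^k(S)}=\sup_{n\le k}\sup_{x\in S}\|D^ng(x)\|$, with the operator norm of $n$-linear maps with respect to Euclidean norms. Let $\pi,\rho\in C^k([0,1]^d)$ be probability densities on $[0,1]^d$, and let $L_1$ and $L_2>0$ be real numbers with $$\|\pi\|_{C^k([0,1]^d)}\le L_1,\quad \|\rho\|_{C^k([0,1]^d)}\le L_1,\quad \inf_{[0,1]^d}\pi\ge L_2,\quad \inf_{[0,1]^d}\rho\ge L_2$$ (so that automatically $L_2\le 1\le L_1$). For $h\in\{\pi,\rho\}$ and $1\le j\le d$ let $F_{h,j}(x_1,\dots,x_{j-1},\cdot)$ be the distribution function of the $j$-th coordinate under $h$ conditioned on the first $j-1$ coordinates, i.e. with $\hat h_j(x_1,\dots,x_j)=\int_{[0,1]^{d-j}}h(x_1,\dots,x_j,t_{j+1},\dots,t_d)\,dt_{j+1}\cdots dt_d$, $$F_{h,j}(x_1,\dots,x_j)=\int_0^{x_j}\frac{\hat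 h_j(x_1,\dots,x_{j-1},u)}{\hat h_{j-1}(x_1,\dots,x_{j-1})}\,du .$$ Let $T=(T_1,\dots,T_d)$ be the Knothe–Rosenblatt map from $\pi$ to $\rho$, given recursively by $$T_j(x)=F_{\rho,j}\bigl(T_1(x),\dots,T_{j-1}(x),\cdot\bigr)^{-1}\bigl(F_{\pi,j}(x_1,\dots,x_j)\bigr),\qquad x\in[0,1]^d,$$ with the inverse taken on $[0,1]$. Then $T$ maps $[0,1]^d$ into $[0,1]^d$, and there is exactly one velocity field $f:[0,1]^d\times[0,1]\to\mathbb R^d$ whose flow is the displacement interpolation $T_t(x)=(1-t)x+tT(x)$, i.e. such that $$\frac{d}{dt}T_t(x)=f(T_t(x),t)\qquad\text{for all }x\in[0,1]^d,\ t\in[0,1].$$ This $f$ is of class $C^k$ on $[0,1]^d\times[0,1]$ and satisfies $$\|f\|_{C^k([0,1]^d\times[0,1])}\le C_{k,d}\left(\frac{L_1}{L_2}\right)^{\beta_d k^{d+3}}.$$ -/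

import Mathlib

open Set MeasureTheory

noncomputable section

/-- The cube `[0,1]^d` in Euclidean space. -/
def unitCube (d : ℕ) : Set (EuclideanSpace ℝ (Fin d)) :=
  {x | ∀ i, x i ∈ Icc (0 : ℝ) 1}

/-- The cylinder `[0,1]^d × [0,1]` in `ℝ^d × ℝ`, where `ℝ^d × ℝ` carries the Euclidean norm
of `ℝ^(d+1)`. -/
def unitCylinder (d : ℕ) : Set (WithLp 2 (EuclideanSpace ℝ (Fin d) × ℝ)) :=
  {z | z.fst ∈ unitCube d ∧ z.snd ∈ Icc (0 : ℝ) 1}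

/-- The norm `‖f‖_{C^k(S)} = sup_{n ≤ k} sup_{x ∈ S} ‖D^n f(x)‖`, with values in `[0, ∞]`, where
`D^n f(x)` is measured in the operator norm of `n`-linear maps. Derivatives are taken within `S`;
it is applied to `C^k` functions on the closed convex sets above, where these are the
continuous extensions to the boundary of the derivatives in the interior. -/
def ckENorm {E F : Type*} [NormedAddCommGroup E] [NormedSpace ℝ E]
    [NormedAddCommGroup F] [NormedSpace ℝ F] (k : ℕ) (S : Set E) (f : E → F) : ENNReal :=
  ⨆ n ∈ Iic k, ⨆ x ∈ S, ‖iteratedFDerivWithin ℝ n f S x‖ₑ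

/-- `p` is (on the cube) a probability density of class `C^k` with `‖p‖_{C^k} ≤ L₁` and
`p ≥ L₂`. Only the values of `p` on the cube matter. -/
structure IsRegularDensity {d : ℕ} (k : ℕ) (L₁ L₂ : ℝ) (p : EuclideanSpace ℝ (Fin d) → ℝ) :
    Prop where
  contDiffOn : ContDiffOn ℝ k p (unitCube d)
  norm_le : ckENorm k (unitCube d) p ≤ ENNReal.ofReal L₁
  le : ∀ x ∈ unitCube d, L₂ ≤ p x
  integral_eq_one : ∫ x in unitCube d, p x = 1

/-- The marginal density of the first `m` coordinates,
`x ↦ ∫ p(x_1, …, x_m, t_{m+1}, …, t_d) dt_{m+1} ⋯ dt_d` over `[0,1]^(d-m)`. The integral is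
written over all `t ∈ [0,1]^d`: the variables `t_1, …, t_m` do not occur in the integrand and
contribute a factor `1`. -/
def marginalDensity {d : ℕ} (p : EuclideanSpace ℝ (Fin d) → ℝ) (m : ℕ)
    (x : EuclideanSpace ℝ (Fin d)) : ℝ :=
  ∫ t in unitCube d, p (WithLp.toLp 2 fun i => if i.val < m then x i else t i)

/-- The point `x` with its `j`-th coordinate replaced by `s`. -/
def setCoord {d : ℕ} (x : EuclideanSpace ℝ (Fin d)) (j : Fin d) (s : ℝ) :
    EuclideanSpace ℝ (Fin d) :=
  WithLp.toLp 2 (Function.update x.ofLp j s)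

/-- The density of the `j`-th coordinate conditioned on the coordinates before it, at `x`. Since
`j` counts from `0`, the coordinates up to and including the `j`-th are the first `j + 1` ones. -/
def condDensity {d : ℕ} (p : EuclideanSpace ℝ (Fin d) → ℝ) (j : Fin d)
    (x : EuclideanSpace ℝ (Fin d)) : ℝ :=
  marginalDensity p (j.val + 1) x / marginalDensity p j.val x

/-- The conditional distribution function `s ↦ F_{p,j}(x_1, …, x_{j-1}, s)` of the `j`-th
coordinate given the coordinates of `x` before it. -/
def condCDF {d : ℕ} (p : EuclideanSpace ℝ (Fin d) → ℝ) (j : Fin d)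
    (x : EuclideanSpace ℝ (Fin d)) (s : ℝ) : ℝ :=
  ∫ u in (0 : ℝ)..s, condDensity p j (setCoord x j u)

/-- The first `m` components of the Knothe–Rosenblatt map at `x` (the later components are still
`0`): component `j` is the preimage in `[0,1]` of `F_{p,j}(x_1, …, x_j)` under
`F_{q,j}(T_1(x), …, T_{j-1}(x), ·)`. -/
def knotheRosenblattAux {d : ℕ} (p q : EuclideanSpace ℝ (Fin d) → ℝ)
    (x : EuclideanSpace ℝ (Fin d)) : ℕ → EuclideanSpace ℝ (Fin d)
  | 0 => 0
  | m + 1 =>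
    if h : m < d then
      setCoord (knotheRosenblattAux p q x m) ⟨m, h⟩
        (Function.invFunOn (condCDF q ⟨m, h⟩ (knotheRosenblattAux p q x m)) (Icc 0 1)
          (condCDF p ⟨m, h⟩ x (x ⟨m, h⟩)))
    else knotheRosenblattAux p q x m

/-- The Knothe–Rosenblatt map from the density `p` to the density `q` on `[0,1]^d`. -/
def knotheRosenblatt {d : ℕ} (p q : EuclideanSpace ℝ (Fin d) → ℝ)
    (x : EuclideanSpace ℝ (Fin d)) : EuclideanSpace ℝ (Fin d) :=
  knotheRosenblattAux p q x d

/-- The displacement interpolation `T_t(x) = (1 - t) x + t T(x)`. -/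
def displacement {d : ℕ} (T : EuclideanSpace ℝ (Fin d) → EuclideanSpace ℝ (Fin d)) (t : ℝ)
    (x : EuclideanSpace ℝ (Fin d)) : EuclideanSpace ℝ (Fin d) :=
  (1 - t) • x + t • T x

/-- `f` is a velocity field whose flow is the displacement interpolation of `T`: for every
`x ∈ [0,1]^d`, the straight line `X(t) = T_t(x)`, which starts at `X(0) = x`, solves
`X'(t) = f(X(t), t)` for `t ∈ [0,1]`. -/
def IsStraightLineVelocity {d : ℕ} (T : EuclideanSpace ℝ (Fin d) → EuclideanSpace ℝ (Fin d))
    (f : WithLp 2 (EuclideanSpace ℝ (Fin d) × ℝ) → EuclideanSpace ℝ (Fin d)) : Prop :=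
  ∀ x ∈ unitCube d, ∀ t ∈ Icc (0 : ℝ) 1,
    HasDerivWithinAt (fun s => displacement T s x)
      (f (WithLp.toLp 2 (displacement T t x, t))) (Icc 0 1) t

end

/-! Write `F_h = (F_{h,1}, …, F_{h,d})`. The recursion for `T` says `F_ρ ∘ T = F_π`, so `T = F_ρ⁻¹ ∘
F_π`. With `H(x, t) = (T_t(x), t)`, the velocity condition says `f(H(x, t)) = T(x) - x`. Once `H` is
a bijection of the cylinder, `f` is therefore forced to be `(T - id) ∘ pr₁ ∘ H⁻¹`. The proof inverts
two maps, `F_ρ` and `H`, and bounds the derivatives of the inverses.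

Bijectivity comes from triangularity (`IsTriangularMap`). If the `j`-th component depends on the
first `j` coordinates and has slope at least `c > 0` in the `j`-th, then the intermediate value
theorem solves for the coordinates one after another, and forward substitution shows that the map
expands distances by a definite factor. Triangularity passes from `F_π`, `F_ρ` to `T`, and from `T`
to every `T_t` with the same constants, since the identity is triangular too.

Derivatives are tracked by `HasGeomBound`, i.e. `‖D^i f‖ ≤ D^(i+1)`, a form stable under products,
composition and inversion of linear maps. For an inverse `G` of `H`, the identity `DG = (DH)⁻¹ ∘ G`
bootstraps regularity and bounds (`HasGeomBound.inverse`); expansion bounds `(DH)⁻¹`. The regularity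
of `F_h` follows by rescaling its integral to the fixed interval `[0,1]`.

Every constant is at most a power of `Q = c · L₁ / L₂`, with `c` depending on `k` and `d`. Each
inversion multiplies the exponent by `O(k)`, and passing from `D` to `D^(i+1)` costs one more factor
`O(k)`. The total `O(k³)` is below `k^(d+3)`. Whole maps are inverted rather than single
coordinates, so `d` enters only through the coefficients. -/

/-! ### Calculus of geometric derivative bounds -/

/-- `f` is of class `C^k` on `S`, and its derivatives there grow at most geometrically. -/
structure HasGeomBound {E F : Type*} [NormedAddCommGroup E] [NormedSpace ℝ E]
    [NormedAddCommGroup F] [NormedSpace ℝ F] (k : ℕ) (D : ℝ) (S : Set E) (f : E → F) : Prop where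
  contDiffOn : ContDiffOn ℝ k f S
  bound : ∀ i ≤ k, ∀ x ∈ S, ‖iteratedFDerivWithin ℝ i f S x‖ ≤ D ^ (i + 1)

namespace HasGeomBound

variable {E F G : Type*} [NormedAddCommGroup E] [NormedSpace ℝ E]
  [NormedAddCommGroup F] [NormedSpace ℝ F] [NormedAddCommGroup G] [NormedSpace ℝ G]
  {k : ℕ} {D D₁ D₂ : ℝ} {S : Set E}

theorem mono {f : E → F} (h : HasGeomBound k D₁ S f) (h0 : 0 ≤ D₁) (h12 : D₁ ≤ D₂) :
    HasGeomBound k D₂ S f :=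
  ⟨h.contDiffOn, fun i hi x hx => (h.bound i hi x hx).trans (pow_le_pow_left₀ h0 h12 _)⟩

theorem congr {f g : E → F} (h : HasGeomBound k D S f) (hfg : EqOn g f S) :
    HasGeomBound k D S g :=
  ⟨h.contDiffOn.congr hfg, fun i hi x hx => by
    rw [iteratedFDerivWithin_congr hfg hx]; exact h.bound i hi x hx⟩

theorem norm_le {f : E → F} (h : HasGeomBound k D S f) {x : E} (hx : x ∈ S) : ‖f x‖ ≤ D := by
  simpa using h.bound 0 (Nat.zero_le k) x hx

theorem const {c : F} (hc : ‖c‖ ≤ D) :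
    HasGeomBound k D S (fun _ => c) := by
  refine ⟨contDiffOn_const, fun i _ x hx => ?_⟩
  rcases i with _ | i
  · simpa using hc
  · rw [iteratedFDerivWithin_succ_const]
    simpa using pow_nonneg ((norm_nonneg c).trans hc) _

theorem clm (hS : UniqueDiffOn ℝ S) (L : E →L[ℝ] F) (h1 : 1 ≤ D) (hL : ‖L‖ ≤ D)
    (hb : ∀ x ∈ S, ‖L x‖ ≤ D) : HasGeomBound k D S L := by
  refine ⟨L.contDiff.contDiffOn, fun i _ x hx => ?_⟩
  rcases i with _ | i
  · simpa using hb x hx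
  · rw [← norm_iteratedFDerivWithin_fderivWithin hS hx,
      iteratedFDerivWithin_congr (f₁ := fderivWithin ℝ L S) (f := fun _ => L)
        (fun y hy => L.fderivWithin (hS y hy)) hx]
    rcases i with _ | i
    · simpa using hL.trans (le_self_pow₀ h1 two_ne_zero)
    · rw [iteratedFDerivWithin_succ_const]
      simpa using pow_nonneg (zero_le_one.trans h1) _

theorem clm_comp (hS : UniqueDiffOn ℝ S) {f : E → F} (h : HasGeomBound k D S f)
    (L : F →L[ℝ] G) (hL : ‖L‖ ≤ 1) : HasGeomBound k D S (fun x => L (f x)) := by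
  refine ⟨L.contDiff.comp_contDiffOn h.contDiffOn, fun i hi x hx => ?_⟩
  refine (L.norm_iteratedFDerivWithin_comp_left (h.contDiffOn x hx) hS hx
    (by exact_mod_cast hi)).trans ?_
  exact (mul_le_of_le_one_left (norm_nonneg _) hL).trans (h.bound i hi x hx)

theorem add (hS : UniqueDiffOn ℝ S) (h1 : 0 ≤ D₁) (h2 : 0 ≤ D₂) {f g : E → F}
    (hf : HasGeomBound k D₁ S f) (hg : HasGeomBound k D₂ S g) :
    HasGeomBound k (D₁ + D₂) S (fun x => f x + g x) := by
  refine ⟨hf.contDiffOn.add hg.contDiffOn, fun i hi x hx => ?_⟩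
  have hi' : (i : WithTop ℕ∞) ≤ k := by exact_mod_cast hi
  rw [fun_iteratedFDerivWithin_add_apply ((hf.contDiffOn x hx).of_le hi')
    ((hg.contDiffOn x hx).of_le hi') hS hx]
  refine (norm_add_le _ _).trans ((add_le_add (hf.bound i hi x hx) (hg.bound i hi x hx)).trans ?_)
  exact pow_add_pow_le h1 h2 (Nat.succ_ne_zero i)

theorem neg (hS : UniqueDiffOn ℝ S) {f : E → F} (hf : HasGeomBound k D S f) :
    HasGeomBound k D S (fun x => - f x) := by
  have := hf.clm_comp hS (-ContinuousLinearMap.id ℝ F) (by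
    rw [norm_neg]; exact ContinuousLinearMap.norm_id_le)
  simpa using this

theorem sum (hS : UniqueDiffOn ℝ S) {ι : Type*} (s : Finset ι) {f : ι → E → F} (h0 : 0 ≤ D)
    (hf : ∀ j ∈ s, HasGeomBound k D S (f j)) :
    HasGeomBound k (s.card * D) S (fun x => ∑ j ∈ s, f j x) := by
  classical
  induction s using Finset.induction_on with
  | empty => simpa using const (k := k) (S := S) (c := (0 : F)) (D := 0) (by simp)
  | insert a s ha ih =>
    have := (hf a (by simp)).add hS h0 (by positivity) (ih fun j hj => hf j (by simp [hj]))
    simp only [Finset.sum_insert ha, Finset.card_insert_of_notMem ha]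
    convert this using 1
    push_cast; ring

/-- Leibniz's rule and the binomial theorem give `D₁ D₂ (D₁ + D₂)^i`, and `D₁ + D₂ ≤ 2 D₁ D₂` since
both are at least `1`. -/
theorem bilin {F' : Type*} [NormedAddCommGroup F'] [NormedSpace ℝ F'] (hS : UniqueDiffOn ℝ S)
    (h1 : 1 ≤ D₁) (h2 : 1 ≤ D₂) (B : F →L[ℝ] F' →L[ℝ] G)
    (hB : ‖B‖ ≤ 1) {f : E → F} {g : E → F'}
    (hf : HasGeomBound k D₁ S f) (hg : HasGeomBound k D₂ S g) :
    HasGeomBound k (2 * D₁ * D₂) S (fun x => B (f x) (g x)) := by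
  refine ⟨B.isBoundedBilinearMap.contDiff.comp_contDiffOn
    (hf.contDiffOn.prodMk hg.contDiffOn), fun i hi x hx => ?_⟩
  refine (B.norm_iteratedFDerivWithin_le_of_bilinear_of_le_one hf.contDiffOn hg.contDiffOn hS hx
    (by exact_mod_cast hi) hB).trans ?_
  calc _ ≤ ∑ j ∈ Finset.range (i + 1), (i.choose j : ℝ) * D₁ ^ (j + 1) * D₂ ^ (i - j + 1) := by
        refine Finset.sum_le_sum fun j hj => ?_
        have hj : j ≤ i := by simpa [Nat.lt_succ_iff] using hj
        gcongr
        · exact hf.bound j (hj.trans hi) x hx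
        · exact hg.bound (i - j) ((Nat.sub_le _ _).trans hi) x hx
    _ = D₁ * D₂ * (D₁ + D₂) ^ i := by
        rw [add_pow, Finset.mul_sum]
        refine Finset.sum_congr rfl fun j _ => ?_
        ring
    _ ≤ (2 * D₁ * D₂) * (2 * D₁ * D₂) ^ i := by
        have h3 : 0 ≤ D₁ * D₂ := by positivity
        gcongr
        · nlinarith
        · nlinarith
    _ = _ := by ring

theorem smul (hS : UniqueDiffOn ℝ S) (h1 : 1 ≤ D₁) (h2 : 1 ≤ D₂) {f : E → ℝ} {g : E → F}
    (hf : HasGeomBound k D₁ S f) (hg : HasGeomBound k D₂ S g) :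
    HasGeomBound k (2 * D₁ * D₂) S (fun x => f x • g x) :=
  hf.bilin hS h1 h2 (ContinuousLinearMap.lsmul ℝ ℝ) ContinuousLinearMap.opNorm_lsmul_le hg

/-- The Faà di Bruno estimate `n! C D^n`. The outer function is controlled only at points of the
image of `f`, which allows one that is unbounded on `T`, such as inversion on the units. -/
theorem comp_of_norm_le {T : Set F} (hS : UniqueDiffOn ℝ S) (hT : UniqueDiffOn ℝ T)
    (h1 : 1 ≤ D₁) (h2 : 1 ≤ D₂) {f : E → F} {g : F → G} (hg : ContDiffOn ℝ k g T)
    (hgb : ∀ x ∈ S, ∀ i ≤ k, ‖iteratedFDerivWithin ℝ i g T (f x)‖ ≤ D₁ ^ (i + 1))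
    (hf : HasGeomBound k D₂ S f) (hST : MapsTo f S T) :
    HasGeomBound k (k.factorial * D₁ * D₂ ^ 2) S (fun x => g (f x)) := by
  refine ⟨hg.comp hf.contDiffOn hST, fun n hn x hx => ?_⟩
  have key := norm_iteratedFDerivWithin_comp_le (n := n) hg hf.contDiffOn (by exact_mod_cast hn)
    hT hS hST hx (C := D₁ ^ (n + 1)) (D := D₂ ^ 2)
    (fun i hi => (hgb x hx i (hi.trans hn)).trans (pow_le_pow_right₀ h1 (by omega)))
    -- The estimate needs bounds of the form `D^i` for `i ≥ 1`; since `i + 1 ≤ 2 i`, the square of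
    -- `D₂` serves.
    (fun i hi hin => (hf.bound i (hin.trans hn) x hx).trans (by
      rw [← pow_mul]; exact pow_le_pow_right₀ h2 (by omega)))
  refine key.trans ?_
  have hk : (n.factorial : ℝ) ≤ k.factorial := by exact_mod_cast Nat.factorial_le hn
  have hk1 : (1 : ℝ) ≤ k.factorial := by exact_mod_cast Nat.factorial_pos k
  rw [mul_pow, mul_pow]
  gcongr
  · exact hk.trans (le_self_pow₀ hk1 (by omega))
  · exact one_le_pow₀ h2
  · omega

theorem comp {T : Set F} (hS : UniqueDiffOn ℝ S) (hT : UniqueDiffOn ℝ T)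
    (h1 : 1 ≤ D₁) (h2 : 1 ≤ D₂) {f : E → F} {g : F → G} (hg : HasGeomBound k D₁ T g)
    (hf : HasGeomBound k D₂ S f) (hST : MapsTo f S T) :
    HasGeomBound k (k.factorial * D₁ * D₂ ^ 2) S (fun x => g (f x)) :=
  comp_of_norm_le hS hT h1 h2 hg.contDiffOn (fun x hx i hi => hg.bound i hi (f x) (hST hx)) hf hST

theorem fderivWithin (hS : UniqueDiffOn ℝ S) (h1 : 1 ≤ D) {f : E → F}
    (hf : HasGeomBound (k + 1) D S f) : HasGeomBound k (D ^ 2) S (fderivWithin ℝ f S) := by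
  refine ⟨hf.contDiffOn.fderivWithin hS (by norm_cast), fun i hi x hx => ?_⟩
  rw [norm_iteratedFDerivWithin_fderivWithin hS hx, ← pow_mul]
  exact (hf.bound (i + 1) (by omega) x hx).trans (pow_le_pow_right₀ h1 (by omega))

end HasGeomBound

/-! ### Derivatives of inversion in a Banach algebra -/

section RingInverse

variable {R : Type*} [NormedRing R] [CompleteSpace R] [NormedAlgebra ℝ R]

theorem uniqueDiffOn_isUnit : UniqueDiffOn ℝ {x : R | IsUnit x} := Units.isOpen.uniqueDiffOn

theorem contDiffOn_ringInverse_isUnit (n : WithTop ℕ∞) :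
    ContDiffOn ℝ n (Ring.inverse : R → R) {x : R | IsUnit x} := by
  rintro x ⟨u, rfl⟩
  exact (contDiffAt_ringInverse ℝ u).contDiffWithinAt

set_option maxSynthPendingDepth 4 in
set_option synthInstance.maxHeartbeats 200000 in
/-- The `n`-th derivative of inversion at `a` has norm at most `n! ‖a⁻¹‖ ^ (n + 1)`. -/
theorem norm_iteratedFDerivWithin_ringInverse_le (n : ℕ) :
    ∀ a : R, IsUnit a → ‖iteratedFDerivWithin ℝ n (Ring.inverse : R → R) {x : R | IsUnit x} a‖
      ≤ n.factorial * ‖Ring.inverse a‖ ^ (n + 1) := by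
  induction n using Nat.strong_induction_on with
  | _ n ih =>
    intro a ha
    rcases n with _ | n
    · simp
    have ha' : a ∈ {x : R | IsUnit x} := ha
    -- The derivative `v ↦ -x⁻¹ v x⁻¹` is bilinear in two copies of inversion, so Leibniz's rule
    -- yields a strong induction.
    have hd : EqOn (fderivWithin ℝ (Ring.inverse : R → R) {x : R | IsUnit x})
        (fun x => (-ContinuousLinearMap.mulLeftRight ℝ R) (Ring.inverse x) (Ring.inverse x))
        {x : R | IsUnit x} := by
      rintro x ⟨u, rfl⟩
      rw [(hasFDerivAt_ringInverse (𝕜 := ℝ) u).hasFDerivWithinAt.fderivWithin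
        (uniqueDiffOn_isUnit _ u.isUnit)]
      simp
    rw [← norm_iteratedFDerivWithin_fderivWithin uniqueDiffOn_isUnit ha',
      iteratedFDerivWithin_congr hd ha']
    refine ((-ContinuousLinearMap.mulLeftRight ℝ R).norm_iteratedFDerivWithin_le_of_bilinear_of_le_one
      (contDiffOn_ringInverse_isUnit n) (contDiffOn_ringInverse_isUnit n) uniqueDiffOn_isUnit ha'
      (n := n) le_rfl 
      ((norm_neg (ContinuousLinearMap.mulLeftRight ℝ R)).trans_le
        (ContinuousLinearMap.opNorm_mulLeftRight_le ℝ R))).trans ?_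
    -- As `choose n i * i! * (n - i)! = n!`, the `n + 1` Leibniz terms have the same bound and add
    -- up to `(n + 1)!`.
    calc _ ≤ ∑ i ∈ Finset.range (n + 1), (n.factorial : ℝ) * ‖Ring.inverse a‖ ^ (n + 2) := by
          refine Finset.sum_le_sum fun i hi => ?_
          have hi : i ≤ n := by simpa [Nat.lt_succ_iff] using hi
          calc _ ≤ (n.choose i : ℝ) * (i.factorial * ‖Ring.inverse a‖ ^ (i + 1)) *
                ((n - i).factorial * ‖Ring.inverse a‖ ^ (n - i + 1)) := by
                gcongr
                · exact ih i (by omega) a ha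
                · exact ih (n - i) (by omega) a ha
            _ = _ := by
                rw [← Nat.choose_mul_factorial_mul_factorial hi,
                  show n + 2 = (i + 1) + (n - i + 1) by omega, pow_add]
                push_cast; ring
      _ = _ := by
          rw [Finset.sum_const, Finset.card_range, Nat.factorial_succ, nsmul_eq_mul]
          push_cast; ring

theorem HasGeomBound.ringInverse {E : Type*} [NormedAddCommGroup E] [NormedSpace ℝ E] {k : ℕ}
    {D r : ℝ} {S : Set E} (hS : UniqueDiffOn ℝ S) (hD : 1 ≤ D) (hr : 1 ≤ r) {A : E → R}
    (hA : HasGeomBound k D S A) (hu : ∀ x ∈ S, IsUnit (A x))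
    (hAr : ∀ x ∈ S, ‖Ring.inverse (A x)‖ ≤ r) :
    HasGeomBound k (k.factorial * (k.factorial * r) * D ^ 2) S
      (fun x => Ring.inverse (A x)) := by
  have hk1 : (1 : ℝ) ≤ k.factorial := by exact_mod_cast Nat.factorial_pos k
  refine HasGeomBound.comp_of_norm_le hS uniqueDiffOn_isUnit
    (one_le_mul_of_one_le_of_one_le hk1 hr) hD (contDiffOn_ringInverse_isUnit k)
    (fun x hx i hi => ?_) hA hu
  refine (norm_iteratedFDerivWithin_ringInverse_le i _ (hu x hx)).trans ?_
  have hk : (i.factorial : ℝ) ≤ k.factorial := by exact_mod_cast Nat.factorial_le hi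
  rw [mul_pow]
  gcongr
  · exact hk.trans (le_self_pow₀ hk1 (by omega))
  · exact hAr x hx

end RingInverse

/-! ### Inverses of expanding maps -/

section Inverse

variable {E : Type*} [NormedAddCommGroup E] [NormedSpace ℝ E] {S : Set E} {H : E → E} {r : ℝ}

/-- A `C¹` map that expands distances on a convex body by at least `1 / r` has a derivative that
expands norms by at least `1 / r`, up to the boundary. -/
theorem norm_le_mul_norm_fderivWithin_of_expanding (hconv : Convex ℝ S) (hcl : IsClosed S)
    (hint : (interior S).Nonempty) (hH : ContDiffOn ℝ 1 H S)
    (hanti : ∀ x ∈ S, ∀ y ∈ S, ‖x - y‖ ≤ r * ‖H x - H y‖) {x : E} (hx : x ∈ S) (v : E) :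
    ‖v‖ ≤ r * ‖fderivWithin ℝ H S x v‖ := by
  have hU : UniqueDiffOn ℝ S := uniqueDiffOn_convex hconv hint
  have hclos : closure (interior S) = S := by
    rw [hconv.closure_interior_eq_closure_of_nonempty_interior hint, hcl.closure_eq]
  -- Difference quotients give the inequality at interior points; continuity of the derivative
  -- carries it to the boundary.
  refine le_on_closure (s := interior S) (f := fun _ => ‖v‖)
    (g := fun x => r * ‖fderivWithin ℝ H S x v‖) (fun z hz => ?_) continuousOn_const ?_
    (x := x) (by rwa [hclos])
  · have hzS : S ∈ nhds z := mem_interior_iff_mem_nhds.1 hz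
    have hd : HasFDerivAt H (fderivWithin ℝ H S z) z :=
      ((hH.differentiableOn one_ne_zero z (interior_subset hz)).hasFDerivWithinAt).hasFDerivAt hzS
    have hl := (hd.hasLineDerivAt v).tendsto_slope_zero_right
    have hl' := (hl.norm).const_mul r
    refine ge_of_tendsto hl' ?_
    have hcont : Filter.Tendsto (fun t : ℝ => z + t • v) (nhdsWithin 0 (Ioi 0)) (nhds z) := by
      have : Continuous fun t : ℝ => z + t • v := by fun_prop
      have := this.tendsto 0
      simp only [zero_smul, add_zero] at this
      exact this.mono_left nhdsWithin_le_nhds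
    filter_upwards [hcont hzS, self_mem_nhdsWithin] with t ht ht0
    have ht0 : 0 < t := ht0
    have h1 := hanti (z + t • v) ht z (interior_subset hz)
    rw [add_sub_cancel_left, norm_smul, Real.norm_of_nonneg ht0.le] at h1
    rw [norm_smul, norm_inv, Real.norm_of_nonneg ht0.le]
    have : r * (t⁻¹ * ‖H (z + t • v) - H z‖) = t⁻¹ * (r * ‖H (z + t • v) - H z‖) := by ring
    rw [this, ← div_eq_inv_mul, le_div_iff₀ ht0, mul_comm]
    exact h1
  · rw [hclos]
    have := hH.continuousOn_fderivWithin hU le_rfl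
    exact continuousOn_const.mul ((this.clm_apply continuousOn_const).norm)

theorem ringInverse_continuousLinearEquiv (e : E ≃L[ℝ] E) :
    Ring.inverse (e : E →L[ℝ] E) = (e.symm : E →L[ℝ] E) := by
  have := ContinuousLinearMap.inverse_equiv e
  rw [← ContinuousLinearMap.ringInverse_eq_inverse] at this
  exact this

variable [FiniteDimensional ℝ E]

/-- Expansion makes `L` injective, hence invertible in finite dimension, and the same inequality at
`e.symm v` bounds the inverse. -/
theorem exists_continuousLinearEquiv_of_expanding {L : E →L[ℝ] E} (hr : 0 ≤ r)
    (hL : ∀ v, ‖v‖ ≤ r * ‖L v‖) :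
    ∃ e : E ≃L[ℝ] E, (e : E →L[ℝ] E) = L ∧ ‖(e.symm : E →L[ℝ] E)‖ ≤ r := by
  have hinj : Function.Injective (L : E →ₗ[ℝ] E) := by
    rw [← LinearMap.ker_eq_bot, LinearMap.ker_eq_bot']
    intro v hv
    have := hL v
    have hv' : L v = 0 := hv
    rw [hv', norm_zero, mul_zero] at this
    exact norm_le_zero_iff.1 this
  let e := (LinearEquiv.ofInjectiveEndo (L : E →ₗ[ℝ] E) hinj).toContinuousLinearEquiv
  have he : (e : E →L[ℝ] E) = L := by ext v; rfl
  refine ⟨e, he, ContinuousLinearMap.opNorm_le_bound _ hr fun v => ?_⟩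
  have h1 := hL (e.symm v)
  rw [← he] at h1
  simpa using h1

variable {k : ℕ} {D : ℝ} {G : E → E}

/-- The inverse of an expanding `C^(k+1)` map of a convex body onto itself is of class `C^(k+1)`,
with geometric bounds on its derivatives. -/
theorem HasGeomBound.inverse (hconv : Convex ℝ S) (hcl : IsClosed S)
    (hint : (interior S).Nonempty) (hD : 1 ≤ D) (hr : 1 ≤ r)
    (hH : HasGeomBound (k + 1) D S H) (hGS : MapsTo G S S) (hHG : ∀ y ∈ S, H (G y) = y)
    (hanti : ∀ x ∈ S, ∀ y ∈ S, ‖x - y‖ ≤ r * ‖H x - H y‖) (hSD : ∀ x ∈ S, ‖x‖ ≤ D) :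
    HasGeomBound (k + 1)
      (k.factorial * (k.factorial * (k.factorial * r) * (D ^ 2) ^ 2) ^ (k + 1)) S G := by
  have hU : UniqueDiffOn ℝ S := uniqueDiffOn_convex hconv hint
  have hk1 : (1 : ℝ) ≤ k.factorial := by exact_mod_cast Nat.factorial_pos k
  have hD2 : (1 : ℝ) ≤ D ^ 2 := one_le_pow₀ hD
  have hH1 : ContDiffOn ℝ 1 H S := hH.contDiffOn.of_le (by norm_cast; omega)
  have hexp : ∀ x ∈ S, ∃ e : E ≃L[ℝ] E, (e : E →L[ℝ] E) = _root_.fderivWithin ℝ H S x ∧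
      ‖(e.symm : E →L[ℝ] E)‖ ≤ r := fun x hx =>
    exists_continuousLinearEquiv_of_expanding (zero_le_one.trans hr)
      (norm_le_mul_norm_fderivWithin_of_expanding hconv hcl hint hH1 hanti hx)
  set Φ : E → E →L[ℝ] E := fun x => Ring.inverse (_root_.fderivWithin ℝ H S x) with hΦ
  have hΦb : HasGeomBound k (k.factorial * (k.factorial * r) * (D ^ 2) ^ 2) S Φ := by
    refine HasGeomBound.ringInverse hU hD2 hr (hH.fderivWithin hU hD) ?_ ?_
    · intro x hx
      obtain ⟨e, he, -⟩ := hexp x hx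
      rw [← he]
      exact ⟨⟨e, e.symm, by ext; simp, by ext; simp⟩, rfl⟩
    · intro x hx
      obtain ⟨e, he, her⟩ := hexp x hx
      rwa [← he, ringInverse_continuousLinearEquiv]
  set A : ℝ := k.factorial * (k.factorial * r) * (D ^ 2) ^ 2 with hA
  have hDA : D ≤ A := by
    rw [hA]
    calc D ≤ D ^ 4 := le_self_pow₀ hD (by norm_num)
      _ = 1 * (1 * 1) * (D ^ 2) ^ 2 := by ring
      _ ≤ _ := by gcongr
  have hA1 : 1 ≤ A := hD.trans hDA
  set M : ℝ := k.factorial * A ^ (k + 1) with hM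
  have hAM : A ≤ M := by
    calc A ≤ A ^ (k + 1) := le_self_pow₀ hA1 (by omega)
      _ ≤ M := le_mul_of_one_le_left (by positivity) hk1
  have hM1 : 1 ≤ M := hA1.trans hAM
  have hGlip : ∀ y ∈ S, ∀ y' ∈ S, ‖G y - G y'‖ ≤ r * ‖y - y'‖ := fun y hy y' hy' => by
    simpa [hHG y hy, hHG y' hy'] using hanti (G y) (hGS hy) (G y') (hGS hy')
  have hGc : ContinuousOn G S := by
    have : LipschitzOnWith r.toNNReal G S := LipschitzOnWith.of_dist_le_mul fun y hy y' hy' => by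
      rw [dist_eq_norm, dist_eq_norm, Real.coe_toNNReal _ (zero_le_one.trans hr)]
      exact hGlip y hy y' hy'
    exact this.continuousOn
  have hGd : ∀ y ∈ S, HasFDerivWithinAt G (Φ (G y)) S y := by
    intro y hy
    obtain ⟨e, he, -⟩ := hexp (G y) (hGS hy)
    have hd := (hH1.differentiableOn one_ne_zero (G y) (hGS hy)).hasFDerivWithinAt
    rw [← he] at hd
    have := HasFDerivWithinAt.of_local_left_inverse
      ((hGc y hy).tendsto_nhdsWithin hGS) hd hy
      (Filter.eventually_of_mem self_mem_nhdsWithin hHG)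
    rwa [show Φ (G y) = (e.symm : E →L[ℝ] E) by
      rw [hΦ]; dsimp only; rw [← he, ringInverse_continuousLinearEquiv]]
  have hfd : EqOn (_root_.fderivWithin ℝ G S) (Φ ∘ G) S := fun y hy =>
    (hGd y hy).fderivWithin (hU y hy)
  -- Bootstrap: if `G` is `C^n`, then `DG = Φ ∘ G` is `C^n`, so `G` is `C^(n+1)`.
  have hGC : ∀ n : ℕ, n ≤ k + 1 → ContDiffOn ℝ n G S := by
    intro n
    induction n with
    | zero => intro _; simpa using hGc
    | succ n ih =>
      intro hn
      push_cast
      rw [contDiffOn_succ_iff_fderivWithin hU]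
      refine ⟨fun y hy => (hGd y hy).differentiableWithinAt, by simp, ?_⟩
      refine ContDiffOn.congr ?_ hfd
      exact (hΦb.contDiffOn.of_le (by exact_mod_cast Nat.le_of_succ_le_succ hn)).comp
        (ih (by omega)) hGS
  -- The same identity bounds `D^(n+1) G` by `n! A^(k+1) M^n`; `M = k! A^(k+1)` is chosen to close
  -- this induction.
  have hb : ∀ n : ℕ, n ≤ k + 1 → 1 ≤ n → ∀ y ∈ S, ‖iteratedFDerivWithin ℝ n G S y‖ ≤ M ^ n := by
    intro n
    induction n using Nat.strong_induction_on with
    | _ n ih =>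
      intro hn h1 y hy
      obtain ⟨n, rfl⟩ : ∃ m, n = m + 1 := ⟨n - 1, by omega⟩
      rw [← norm_iteratedFDerivWithin_fderivWithin hU hy, iteratedFDerivWithin_congr hfd hy]
      have hnk : n ≤ k := by omega
      refine (norm_iteratedFDerivWithin_comp_le (n := n) (N := n) (C := A ^ (k + 1)) (D := M)
        (hΦb.contDiffOn.of_le (by exact_mod_cast hnk)) (hGC n (by omega)) le_rfl hU hU hGS hy
        (fun i hi => (hΦb.bound i (by omega) _ (hGS hy)).trans
          (pow_le_pow_right₀ hA1 (by omega)))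
        (fun i hi hin => ih i (by omega) (by omega) hi y hy)).trans ?_
      rw [pow_succ' M n]
      gcongr
      rw [hM]
      gcongr
  refine ⟨hGC (k + 1) le_rfl, fun i hi y hy => ?_⟩
  rcases Nat.eq_zero_or_pos i with rfl | hi0
  -- Order zero lies outside the induction; it uses only that `G` takes values in the bounded set
  -- `S`.
  · simpa using (hSD _ (hGS hy)).trans (hDA.trans hAM)
  · exact (hb i hi hi0 y hy).trans (pow_le_pow_right₀ hM1 (by omega))

end Inverse

/-! ### Differentiation under the integral over a compact set -/

section ParametricIntegral

variable {Ω : Type*} [MetricSpace Ω] [MeasurableSpace Ω] [BorelSpace Ω] {μ : Measure Ω}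
  [IsFiniteMeasureOnCompacts μ] {K : Set Ω}
  {E F : Type*} [NormedAddCommGroup E] [NormedAddCommGroup F] {S : Set E}

theorem integrableOn_fiber_of_continuousOn (hK : IsCompact K) {φ : E → Ω → F}
    (hφ : ContinuousOn φ.uncurry (S ×ˢ K)) {x : E} (hx : x ∈ S) : IntegrableOn (φ x) K μ :=
  ContinuousOn.integrableOn_compact hK
    (hφ.comp (f := fun ω => (x, ω)) (by fun_prop) fun _ hω => ⟨hx, hω⟩)

variable [NormedSpace ℝ F]

theorem continuousOn_setIntegral_of_isCompact (hK : IsCompact K) {φ : E → Ω → F}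
    (hφ : ContinuousOn φ.uncurry (S ×ˢ K)) :
    ContinuousOn (fun x => ∫ ω in K, φ x ω ∂μ) S := by
  intro x hx
  rw [ContinuousWithinAt, Metric.tendsto_nhds]
  intro ε hε
  -- Adding `1` keeps the divisor positive when `K` has measure zero.
  have hμ : 0 < μ.real K + 1 := by positivity
  obtain ⟨v, hv, hvu⟩ := hK.mem_uniformity_of_prod hφ hx
    (Metric.dist_mem_uniformity (div_pos hε hμ))
  filter_upwards [hv, self_mem_nhdsWithin] with y hy hyS
  rw [dist_eq_norm, ← integral_sub (integrableOn_fiber_of_continuousOn hK hφ hyS)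
    (integrableOn_fiber_of_continuousOn hK hφ hx)]
  refine (norm_setIntegral_le_of_norm_le_const (C := ε / (μ.real K + 1)) hK.measure_lt_top
    fun ω hω => ?_).trans_lt ?_
  · rw [← dist_eq_norm]; exact (hvu y hy ω hω).le
  · rw [div_mul_eq_mul_div, div_lt_iff₀ hμ]
    nlinarith

variable [NormedSpace ℝ E]

/-- Differentiation under the integral sign within a convex set. -/
theorem hasFDerivWithinAt_setIntegral_of_continuousOn [CompleteSpace F] (hK : IsCompact K)
    (hS : Convex ℝ S) {φ : E → Ω → F} {φ' : E → Ω → E →L[ℝ] F}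
    (hφ : ContinuousOn φ.uncurry (S ×ˢ K)) (hφ' : ContinuousOn φ'.uncurry (S ×ˢ K))
    (hd : ∀ ω ∈ K, ∀ x ∈ S, HasFDerivWithinAt (fun y => φ y ω) (φ' x ω) S x) {x : E}
    (hx : x ∈ S) :
    HasFDerivWithinAt (fun y => ∫ ω in K, φ y ω ∂μ) (∫ ω in K, φ' x ω ∂μ) S x := by
  rw [hasFDerivWithinAt_iff_isLittleO, Asymptotics.isLittleO_iff]
  intro ε hε
  have hμ : 0 < μ.real K + 1 := by positivity
  obtain ⟨v, hv, hvu⟩ := hK.mem_uniformity_of_prod hφ' hx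
    (Metric.dist_mem_uniformity (div_pos hε hμ))
  obtain ⟨δ, hδ, hball⟩ := Metric.mem_nhdsWithin_iff.1 hv
  filter_upwards [self_mem_nhdsWithin, mem_nhdsWithin_of_mem_nhds (Metric.ball_mem_nhds x hδ)]
    with y hyS hyb
  have hi1 := integrableOn_fiber_of_continuousOn (μ := μ) hK hφ hyS
  have hi2 := integrableOn_fiber_of_continuousOn (μ := μ) hK hφ hx
  have hi3 := integrableOn_fiber_of_continuousOn (μ := μ) hK hφ' hx
  rw [ContinuousLinearMap.integral_apply hi3, ← integral_sub hi1 hi2,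
    ← integral_sub (f := fun ω => φ y ω - φ x ω) (hi1.sub hi2) (hi3.apply_continuousLinearMap _)]
  refine (norm_setIntegral_le_of_norm_le_const (C := ε / (μ.real K + 1) * ‖y - x‖)
    hK.measure_lt_top fun ω hω => ?_).trans ?_
  -- Mean value inequality near `x`: by compactness of `K`, `φ'` varies little there, uniformly in
  -- `ω`.
  · refine Convex.norm_image_sub_le_of_norm_hasFDerivWithin_le' (f := fun y => φ y ω)
      (f' := fun z => φ' z ω) (s := Metric.ball x δ ∩ S)
      (fun z hz => (hd ω hω z hz.2).mono inter_subset_right) (fun z hz => ?_)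
      ((convex_ball x δ).inter hS) ⟨Metric.mem_ball_self hδ, hx⟩ ⟨hyb, hyS⟩
    rw [← dist_eq_norm]
    exact (hvu z (hball hz) ω hω).le
  · have : ε / (μ.real K + 1) * ‖y - x‖ * μ.real K
        = ε * ‖y - x‖ * (μ.real K / (μ.real K + 1)) := by ring
    rw [this]
    refine mul_le_of_le_one_right (by positivity) ?_
    rw [div_le_one hμ]; linarith

-- Integrating whole Taylor series term by term handles all orders at once and identifies the
-- derivatives of the integral.
set_option maxSynthPendingDepth 4 in
set_option synthInstance.maxHeartbeats 200000 in
theorem HasFTaylorSeriesUpToOn.setIntegral [CompleteSpace F] (hK : IsCompact K)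
    (hKm : MeasurableSet K)
    (hS : Convex ℝ S) {n : ℕ} {φ : E → Ω → F} {q : E → Ω → FormalMultilinearSeries ℝ E F}
    (hφ : ∀ ω ∈ K, HasFTaylorSeriesUpToOn n (fun x => φ x ω) (fun x => q x ω) S)
    (hq : ∀ m ≤ n, ContinuousOn (fun z : E × Ω => q z.1 z.2 m) (S ×ˢ K)) :
    HasFTaylorSeriesUpToOn n (fun x => ∫ ω in K, φ x ω ∂μ)
      (fun x m => ∫ ω in K, q x ω m ∂μ) S where
  zero_eq x hx := by
    have h := (continuousMultilinearCurryFin0 ℝ E F).toContinuousLinearEquiv.integral_comp_comm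
      (μ := μ.restrict K) (fun ω => q x ω 0)
    refine h.symm.trans ?_
    refine setIntegral_congr_fun hKm fun ω hω => ?_
    exact (hφ ω hω).zero_eq x hx
  fderivWithin m hm x hx := by
    have hm' : m < n := by exact_mod_cast hm
    have hc : ContinuousOn (fun z : E × Ω => (q z.1 z.2 (m + 1)).curryLeft) (S ×ˢ K) :=
      (continuousMultilinearCurryLeftEquiv ℝ
        (fun _ : Fin (m + 1) => E) F).continuous.comp_continuousOn (hq (m + 1) hm')
    have hi1 : IntegrableOn (fun ω => q x ω (m + 1)) K μ :=
      integrableOn_fiber_of_continuousOn hK (φ := fun x ω => q x ω (m + 1)) (hq (m + 1) hm') hx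
    have hi2 : IntegrableOn (fun ω => (q x ω (m + 1)).curryLeft) K μ :=
      integrableOn_fiber_of_continuousOn hK (φ := fun x ω => (q x ω (m + 1)).curryLeft) hc hx
    have h : ∫ ω in K, (q x ω (m + 1)).curryLeft ∂μ
        = (∫ ω in K, q x ω (m + 1) ∂μ).curryLeft := by
      ext v w
      rw [ContinuousLinearMap.integral_apply hi2,
        ContinuousMultilinearMap.integral_apply (hi2.apply_continuousLinearMap v),
        ContinuousMultilinearMap.curryLeft_apply, ContinuousMultilinearMap.integral_apply hi1]
      rfl
    have h2 := hasFDerivWithinAt_setIntegral_of_continuousOn (μ := μ) hK hS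
      (φ := fun x ω => q x ω m) (φ' := fun x ω => (q x ω (m + 1)).curryLeft)
      (hq m hm'.le) ?_ (fun ω hω x hx => (hφ ω hω).fderivWithin m hm x hx) hx
    · exact h2.congr_fderiv h
    · exact hc
  cont m hm := continuousOn_setIntegral_of_isCompact hK (φ := fun x ω => q x ω m)
    (hq m (by exact_mod_cast hm))

/-- Averages of `g` over affine images of the argument inherit the bounds of `g`. -/
theorem HasGeomBound.setIntegral_affine [CompleteSpace F] (hK : IsCompact K)
    (hKm : MeasurableSet K) (hμ : μ.real K ≤ 1) (hS : Convex ℝ S) (hU : UniqueDiffOn ℝ S)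
    {k : ℕ} {D : ℝ} (hD : 0 ≤ D) {g : E → F} (hg : HasGeomBound k D S g)
    {P : Ω → E →L[ℝ] E} {b : Ω → E} (hP : ContinuousOn P K) (hb : ContinuousOn b K)
    (hP1 : ∀ ω ∈ K, ‖P ω‖ ≤ 1) (hmaps : ∀ ω ∈ K, ∀ x ∈ S, P ω x + b ω ∈ S) :
    HasGeomBound k D S (fun x => ∫ ω in K, g (P ω x + b ω) ∂μ) := by
  have hser := hg.contDiffOn.ftaylorSeriesWithin hU
  let a : Ω → E →ᴬ[ℝ] E := fun ω =>
    (P ω).toContinuousAffineMap + ContinuousAffineMap.const ℝ E (b ω)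
  have ha : ∀ ω, (a ω).contLinear = P ω := fun ω => by
    simp only [a, ContinuousAffineMap.add_contLinear, ContinuousAffineMap.const_contLinear,
      ContinuousLinearMap.toContinuousAffineMap_contLinear, add_zero]
  -- An inner affine map only inserts `P ω` into every argument of the derivative of `g`; as `‖P ω‖
  -- ≤ 1`, no constant is lost.
  have hφ : ∀ ω ∈ K, HasFTaylorSeriesUpToOn k (fun x => g (P ω x + b ω))
      (fun x m => (iteratedFDerivWithin ℝ m g S (P ω x + b ω)).compContinuousLinearMap
        fun _ => P ω) S := fun ω hω => by
    have := (hser.comp_continuousAffineMap (a ω)).mono (t := S) fun x hx => hmaps ω hω x hx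
    rw [ha] at this
    exact this
  have haff : ContinuousOn (fun z : E × Ω => P z.2 z.1 + b z.2) (S ×ˢ K) := by
    have h2 : MapsTo (fun z : E × Ω => z.2) (S ×ˢ K) K := fun z hz => hz.2
    exact ((hP.comp continuousOn_snd h2).clm_apply continuousOn_fst).add
      (hb.comp continuousOn_snd h2)
  have hq : ∀ m ≤ k, ContinuousOn (fun z : E × Ω =>
      (iteratedFDerivWithin ℝ m g S (P z.2 z.1 + b z.2)).compContinuousLinearMap
        fun _ => P z.2) (S ×ˢ K) := fun m hm => by
    have h2 : MapsTo (fun z : E × Ω => z.2) (S ×ˢ K) K := fun z hz => hz.2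
    have h3 : ContinuousOn (fun z : E × Ω => fun _ : Fin m => P z.2) (S ×ˢ K) :=
      continuousOn_pi.2 fun _ => hP.comp continuousOn_snd h2
    have h4 := (ContinuousMultilinearMap.compContinuousLinearMapContinuousMultilinear ℝ
      (fun _ : Fin m => E) (fun _ : Fin m => E) F).cont.comp_continuousOn h3
    exact h4.clm_apply ((hser.cont m (by exact_mod_cast hm)).comp haff
      fun z hz => hmaps z.2 hz.2 z.1 hz.1)
  have hI := HasFTaylorSeriesUpToOn.setIntegral (μ := μ) hK hKm hS hφ hq
  refine ⟨hI.contDiffOn, fun i hi x hx => ?_⟩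
  rw [← hI.eq_iteratedFDerivWithin_of_uniqueDiffOn (by exact_mod_cast hi) hU hx]
  have hDi : 0 ≤ D ^ (i + 1) := by positivity
  refine (norm_setIntegral_le_of_norm_le_const (C := D ^ (i + 1)) hK.measure_lt_top
    fun ω hω => ?_).trans (mul_le_of_le_one_right hDi hμ)
  refine (ContinuousMultilinearMap.norm_compContinuousLinearMap_le _ _).trans ?_
  rw [Finset.prod_const]
  exact (mul_le_of_le_one_right (norm_nonneg _) (pow_le_one₀ (norm_nonneg _) (hP1 ω hω))).trans
    (hg.bound i hi _ (hmaps ω hω x hx))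

end ParametricIntegral

/-! ### The unit cube as a convex body and a product probability space -/

section Cube

variable {d : ℕ}

theorem unitCube_eq_preimage (d : ℕ) :
    unitCube d = (WithLp.ofLp : EuclideanSpace ℝ (Fin d) → Fin d → ℝ) ⁻¹'
      (univ.pi fun _ => Icc (0 : ℝ) 1) := by
  ext x; simp only [unitCube, mem_preimage, mem_pi, mem_univ, true_imp_iff, mem_ofPred_eq]

theorem convex_unitCube (d : ℕ) : Convex ℝ (unitCube d) := by
  intro x hx y hy a b ha hb hab i
  exact convex_Icc (0 : ℝ) 1 (hx i) (hy i) ha hb hab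

theorem isCompact_unitCube (d : ℕ) : IsCompact (unitCube d) := by
  rw [unitCube_eq_preimage]
  exact (PiLp.homeomorph 2 (fun _ : Fin d => ℝ)).isCompact_preimage.2
    (isCompact_univ_pi fun _ => isCompact_Icc)

theorem isClosed_unitCube (d : ℕ) : IsClosed (unitCube d) := (isCompact_unitCube d).isClosed

theorem measurableSet_unitCube (d : ℕ) : MeasurableSet (unitCube d) :=
  (isClosed_unitCube d).measurableSet

theorem nonempty_interior_unitCube (d : ℕ) : (interior (unitCube d)).Nonempty := by
  refine ⟨WithLp.toLp 2 fun _ => 1 / 2, ?_⟩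
  rw [mem_interior]
  refine ⟨(WithLp.ofLp : EuclideanSpace ℝ (Fin d) → Fin d → ℝ) ⁻¹'
      (univ.pi fun _ => Ioo (0 : ℝ) 1), ?_, ?_, ?_⟩
  · rw [unitCube_eq_preimage]
    exact preimage_mono (pi_mono fun _ _ => Ioo_subset_Icc_self)
  · exact (isOpen_set_pi finite_univ fun _ _ => isOpen_Ioo).preimage
      (PiLp.continuous_ofLp 2 _)
  · simp only [mem_preimage, mem_pi, mem_univ, mem_Ioo, true_imp_iff]
    intro _; norm_num

theorem uniqueDiffOn_unitCube (d : ℕ) : UniqueDiffOn ℝ (unitCube d) :=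
  uniqueDiffOn_convex (convex_unitCube d) (nonempty_interior_unitCube d)

theorem norm_le_sum_abs (x : EuclideanSpace ℝ (Fin d)) : ‖x‖ ≤ ∑ i, |x i| := by
  rw [EuclideanSpace.norm_eq]
  refine Real.sqrt_le_iff.2 ⟨Finset.sum_nonneg fun _ _ => abs_nonneg _, ?_⟩
  simpa using Finset.sum_sq_le_sq_sum_of_nonneg (s := Finset.univ) (f := fun i => |x i|)
    fun i _ => abs_nonneg _

theorem norm_le_card_mul {c : ℝ} (x : EuclideanSpace ℝ (Fin d)) (h : ∀ i, |x i| ≤ c) :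
    ‖x‖ ≤ d * c := by
  refine (norm_le_sum_abs x).trans ((Finset.sum_le_sum fun i _ => h i).trans ?_)
  simp

theorem norm_le_of_mem_unitCube {x : EuclideanSpace ℝ (Fin d)} (hx : x ∈ unitCube d) :
    ‖x‖ ≤ d := by
  simpa using norm_le_card_mul x fun i => abs_le.2 ⟨by linarith [(hx i).1], (hx i).2⟩

@[simp] theorem setCoord_apply (x : EuclideanSpace ℝ (Fin d)) (j : Fin d) (s : ℝ) (i : Fin d) :
    setCoord x j s i = if i = j then s else x i := by
  simp [setCoord, Function.update_apply]

theorem setCoord_mem_unitCube {x : EuclideanSpace ℝ (Fin d)} (hx : x ∈ unitCube d) (j : Fin d)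
    {s : ℝ} (hs : s ∈ Icc (0 : ℝ) 1) : setCoord x j s ∈ unitCube d := by
  intro i
  rw [setCoord_apply]
  split_ifs
  exacts [hs, hx i]

theorem setCoord_self (x : EuclideanSpace ℝ (Fin d)) (j : Fin d) : setCoord x j (x j) = x := by
  ext i
  rw [setCoord_apply]
  split_ifs with h
  exacts [by rw [h], rfl]

theorem continuous_setCoord (x : EuclideanSpace ℝ (Fin d)) (j : Fin d) :
    Continuous (setCoord x j) := by
  unfold setCoord
  exact (PiLp.continuous_toLp 2 _).comp (continuous_const.update j continuous_id)

theorem measurePreserving_toLp_unitCube (d : ℕ) :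
    MeasurePreserving (WithLp.toLp 2 : (Fin d → ℝ) → EuclideanSpace ℝ (Fin d))
      (Measure.pi fun _ => (volume : Measure ℝ).restrict (Icc 0 1))
      (volume.restrict (unitCube d)) := by
  have h := (PiLp.volume_preserving_toLp (Fin d)).restrict_preimage (measurableSet_unitCube d)
  have h2 : (WithLp.toLp 2 : (Fin d → ℝ) → EuclideanSpace ℝ (Fin d)) ⁻¹' unitCube d
      = univ.pi fun _ => Icc (0 : ℝ) 1 := by
    ext x; simp only [unitCube, mem_preimage, mem_pi, mem_univ, true_imp_iff, mem_ofPred_eq]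
  rw [h2, volume_pi, Measure.restrict_pi_pi] at h
  exact h

instance isProbabilityMeasure_restrict_Icc_zero_one :
    IsProbabilityMeasure ((volume : Measure ℝ).restrict (Icc 0 1)) := ⟨by simp⟩

instance isProbabilityMeasure_restrict_unitCube :
    IsProbabilityMeasure ((volume : Measure (EuclideanSpace ℝ (Fin d))).restrict (unitCube d)) :=
  ⟨by
    have h := measurePreserving_toLp_unitCube d
    rw [← h.map_eq, Measure.map_apply h.measurable .univ, preimage_univ, measure_univ]⟩

theorem volume_real_unitCube (d : ℕ) : volume.real (unitCube d) = 1 := by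
  have := measure_univ (μ := (volume : Measure (EuclideanSpace ℝ (Fin d))).restrict (unitCube d))
  rw [Measure.restrict_apply_univ] at this
  simp [Measure.real, this]

/-- Resampling one coordinate independently preserves a product of probability measures: on boxes,
the discarded coordinate contributes mass `1`. -/
theorem measurePreserving_update_pi {ι : Type*} [Fintype ι] [DecidableEq ι] {α : ι → Type*}
    [∀ i, MeasurableSpace (α i)] (ν : ∀ i, Measure (α i)) [∀ i, IsProbabilityMeasure (ν i)]
    (j : ι) :
    MeasurePreserving (fun z : α j × (∀ i, α i) => Function.update z.2 j z.1)
      ((ν j).prod (Measure.pi ν)) (Measure.pi ν) := by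
  have hm : Measurable fun z : α j × (∀ i, α i) => Function.update z.2 j z.1 := by
    refine measurable_pi_lambda _ fun i => ?_
    by_cases h : i = j
    · subst h; simpa using measurable_fst
    · simp only [Function.update_of_ne h]
      exact (measurable_pi_apply i).comp measurable_snd
  refine ⟨hm, (Measure.pi_eq fun s hs => ?_).symm⟩
  rw [Measure.map_apply hm (MeasurableSet.univ_pi hs)]
  have hpre : (fun z : α j × (∀ i, α i) => Function.update z.2 j z.1) ⁻¹' univ.pi s
      = s j ×ˢ univ.pi (Function.update s j univ) := by
    ext z
    simp only [mem_preimage, mem_pi, mem_univ, true_imp_iff, mem_prod]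
    constructor
    · intro h
      refine ⟨by simpa using h j, fun i => ?_⟩
      by_cases hi : i = j
      · subst hi; simp
      · simpa [Function.update_of_ne hi] using h i
    · rintro ⟨h1, h2⟩ i
      by_cases hi : i = j
      · subst hi; simpa using h1
      · simpa [Function.update_of_ne hi] using h2 i
  rw [hpre, Measure.prod_prod, Measure.pi_pi, ← Finset.mul_prod_erase Finset.univ _
    (Finset.mem_univ j), ← Finset.mul_prod_erase Finset.univ (fun i => ν i (s i))
    (Finset.mem_univ j)]
  simp only [Function.update_self, measure_univ, one_mul]
  congr 1
  refine Finset.prod_congr rfl fun i hi => ?_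
  rw [Function.update_of_ne (Finset.ne_of_mem_erase hi)]

theorem measurePreserving_setCoord (j : Fin d) :
    MeasurePreserving (fun z : ℝ × EuclideanSpace ℝ (Fin d) => setCoord z.2 j z.1)
      (((volume : Measure ℝ).restrict (Icc 0 1)).prod (volume.restrict (unitCube d)))
      (volume.restrict (unitCube d)) := by
  have h1 := measurePreserving_toLp_unitCube d
  have h2 : MeasurePreserving (WithLp.ofLp : EuclideanSpace ℝ (Fin d) → Fin d → ℝ)
      (volume.restrict (unitCube d))
      (Measure.pi fun _ => (volume : Measure ℝ).restrict (Icc 0 1)) :=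
    MeasurePreserving.symm (MeasurableEquiv.toLp 2 (Fin d → ℝ)) h1
  exact h1.comp ((measurePreserving_update_pi
    (fun _ : Fin d => (volume : Measure ℝ).restrict (Icc 0 1)) j).comp
      ((MeasurePreserving.id _).prod h2))

/-- Integrating over the cube, one coordinate can be integrated out separately. -/
theorem integral_setCoord_unitCube (j : Fin d) {φ : EuclideanSpace ℝ (Fin d) → ℝ}
    (hφ : ContinuousOn φ (unitCube d)) :
    ∫ s in (0 : ℝ)..1, ∫ t in unitCube d, φ (setCoord t j s) = ∫ t in unitCube d, φ t := by
  have hmp := measurePreserving_setCoord j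
  have hint : Integrable φ (volume.restrict (unitCube d)) :=
    hφ.integrableOn_compact (isCompact_unitCube d)
  have hint2 := hmp.integrable_comp_of_integrable hint
  have h : ∫ t in unitCube d, φ t = ∫ z, φ (setCoord z.2 j z.1)
      ∂((volume : Measure ℝ).restrict (Icc 0 1)).prod (volume.restrict (unitCube d)) := by
    rw [← integral_map hmp.measurable.aemeasurable
      (by rw [hmp.map_eq]; exact hint.aestronglyMeasurable), hmp.map_eq]
  rw [h, intervalIntegral.integral_of_le zero_le_one, ← integral_Icc_eq_integral_Ioc]
  exact (integral_prod _ hint2).symm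

end Cube

/-! ### The space-time cylinder -/

section Cylinder

variable (d : ℕ)

theorem convex_unitCylinder : Convex ℝ (unitCylinder d) := by
  intro x hx y hy a b ha hb hab
  exact ⟨convex_unitCube d hx.1 hy.1 ha hb hab, convex_Icc (0 : ℝ) 1 hx.2 hy.2 ha hb hab⟩

theorem unitCylinder_eq_preimage : unitCylinder d =
    (WithLp.prodContinuousLinearEquiv 2 ℝ (EuclideanSpace ℝ (Fin d)) ℝ) ⁻¹'
      (unitCube d ×ˢ Icc (0 : ℝ) 1) := rfl

theorem isClosed_unitCylinder : IsClosed (unitCylinder d) := by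
  rw [unitCylinder_eq_preimage]
  exact ((isClosed_unitCube d).prod isClosed_Icc).preimage
    (WithLp.prodContinuousLinearEquiv 2 ℝ (EuclideanSpace ℝ (Fin d)) ℝ).continuous

theorem nonempty_interior_unitCylinder : (interior (unitCylinder d)).Nonempty := by
  obtain ⟨x, hx⟩ := nonempty_interior_unitCube d
  refine ⟨WithLp.toLp 2 (x, 1 / 2), ?_⟩
  rw [unitCylinder_eq_preimage]
  refine preimage_interior_subset_interior_preimage (ContinuousLinearEquiv.continuous _) ?_
  rw [mem_preimage, interior_prod_eq, interior_Icc]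
  exact ⟨hx, by norm_num, by norm_num⟩

theorem uniqueDiffOn_convex_of_normedSpace {E : Type*} [NormedAddCommGroup E] [NormedSpace ℝ E]
    {S : Set E} (hS : Convex ℝ S) (hi : (interior S).Nonempty) : UniqueDiffOn ℝ S :=
  uniqueDiffOn_convex hS hi

theorem uniqueDiffOn_unitCylinder : UniqueDiffOn ℝ (unitCylinder d) :=
  uniqueDiffOn_convex_of_normedSpace (convex_unitCylinder d) (nonempty_interior_unitCylinder d)

variable {d}

theorem norm_le_norm_fst_add_norm_snd (z : WithLp 2 (EuclideanSpace ℝ (Fin d) × ℝ)) :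
    ‖z‖ ≤ ‖z.fst‖ + |z.snd| := by
  rw [WithLp.prod_norm_eq_of_L2]
  refine Real.sqrt_le_iff.2 ⟨by positivity, ?_⟩
  rw [Real.norm_eq_abs]
  nlinarith [norm_nonneg z.fst, abs_nonneg z.snd]

theorem norm_fst_le_norm (z : WithLp 2 (EuclideanSpace ℝ (Fin d) × ℝ)) : ‖z.fst‖ ≤ ‖z‖ := by
  rw [WithLp.prod_norm_eq_of_L2]
  exact Real.le_sqrt_of_sq_le (by nlinarith [sq_nonneg ‖z.snd‖])

theorem norm_snd_le_norm (z : WithLp 2 (EuclideanSpace ℝ (Fin d) × ℝ)) : |z.snd| ≤ ‖z‖ := by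
  rw [WithLp.prod_norm_eq_of_L2, ← Real.norm_eq_abs]
  exact Real.le_sqrt_of_sq_le (by nlinarith [sq_nonneg ‖z.fst‖])

theorem norm_le_of_mem_unitCylinder {z : WithLp 2 (EuclideanSpace ℝ (Fin d) × ℝ)}
    (hz : z ∈ unitCylinder d) : ‖z‖ ≤ d + 1 :=
  (norm_le_norm_fst_add_norm_snd z).trans (add_le_add (norm_le_of_mem_unitCube hz.1)
    (abs_le.2 ⟨by linarith [hz.2.1], hz.2.2⟩))

end Cylinder

/-! ### Marginals and conditional distribution functions -/

noncomputable section

section Densities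

variable {d : ℕ}

/-- Multiplication of the coordinates by the entries of `c`. -/
def diagCLM (c : Fin d → ℝ) : EuclideanSpace ℝ (Fin d) →L[ℝ] EuclideanSpace ℝ (Fin d) :=
  LinearMap.toContinuousLinearMap
    { toFun := fun x => WithLp.toLp 2 fun i => c i * x i
      map_add' := fun x y => by ext i; simp [mul_add]
      map_smul' := fun a x => by ext i; simp [mul_left_comm] }

@[simp] theorem diagCLM_apply (c : Fin d → ℝ) (x : EuclideanSpace ℝ (Fin d)) (i : Fin d) :
    diagCLM c x i = c i * x i := rfl

theorem norm_diagCLM_le {c : Fin d → ℝ} (hc : ∀ i, |c i| ≤ 1) : ‖diagCLM c‖ ≤ 1 := by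
  refine ContinuousLinearMap.opNorm_le_bound _ zero_le_one fun x => ?_
  rw [one_mul, EuclideanSpace.norm_eq, EuclideanSpace.norm_eq]
  refine Real.sqrt_le_sqrt (Finset.sum_le_sum fun i _ => ?_)
  rw [diagCLM_apply, norm_mul]
  exact pow_le_pow_left₀ (by positivity) (mul_le_of_le_one_left (norm_nonneg _) (hc i)) 2

/-- Common form of `marginalDensity` and `scaledMarginal`: each coordinate of the argument is kept,
scaled or replaced, according to `t`. -/
theorem HasGeomBound.setIntegral_diag {k : ℕ} {D : ℝ} (hD : 0 ≤ D)
    {p : EuclideanSpace ℝ (Fin d) → ℝ} (hp : HasGeomBound k D (unitCube d) p)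
    {c b : EuclideanSpace ℝ (Fin d) → Fin d → ℝ} (hc : ∀ i, Continuous fun t => c t i)
    (hb : ∀ i, Continuous fun t => b t i) (hc1 : ∀ t ∈ unitCube d, ∀ i, |c t i| ≤ 1)
    (hmaps : ∀ t ∈ unitCube d, ∀ x ∈ unitCube d, ∀ i, c t i * x i + b t i ∈ Icc (0 : ℝ) 1) :
    HasGeomBound k D (unitCube d)
      (fun x => ∫ t in unitCube d, p (WithLp.toLp 2 fun i => c t i * x i + b t i)) := by
  refine HasGeomBound.setIntegral_affine (isCompact_unitCube d) (measurableSet_unitCube d)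
    (volume_real_unitCube d).le (convex_unitCube d) (uniqueDiffOn_unitCube d) hD hp
    (P := fun t => diagCLM (c t)) (b := fun t => WithLp.toLp 2 (b t)) ?_ ?_
    (fun t ht => norm_diagCLM_le (hc1 t ht)) hmaps
  · refine (continuous_clm_apply.2 fun x => ?_).continuousOn
    exact (PiLp.continuous_toLp 2 _).comp (continuous_pi fun i => (hc i).mul continuous_const)
  · exact ((PiLp.continuous_toLp 2 _).comp (continuous_pi hb)).continuousOn

theorem marginalDensity_congr (p : EuclideanSpace ℝ (Fin d) → ℝ) {m : ℕ}
    {x y : EuclideanSpace ℝ (Fin d)} (h : ∀ i : Fin d, i.val < m → x i = y i) :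
    marginalDensity p m x = marginalDensity p m y := by
  unfold marginalDensity
  have : ∀ t : EuclideanSpace ℝ (Fin d), (fun i : Fin d => if i.val < m then x i else t i)
      = fun i : Fin d => if i.val < m then y i else t i := fun t => by
    ext i
    split_ifs with hi
    exacts [h i hi, rfl]
  simp only [this]

theorem condCDF_congr (p : EuclideanSpace ℝ (Fin d) → ℝ) {j : Fin d}
    {x y : EuclideanSpace ℝ (Fin d)} (h : ∀ i < j, x i = y i) :
    condCDF p j x = condCDF p j y := by
  ext s
  unfold condCDF condDensity
  have h1 : ∀ u, marginalDensity p (j.val + 1) (setCoord x j u)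
      = marginalDensity p (j.val + 1) (setCoord y j u) := fun u =>
    marginalDensity_congr p fun i hi => by
      simp only [setCoord_apply]
      split_ifs with hij
      · rfl
      · exact h i (lt_of_le_of_ne (Fin.le_def.2 (Nat.lt_succ_iff.1 hi)) hij)
  have h2 : ∀ u, marginalDensity p j.val (setCoord x j u)
      = marginalDensity p j.val (setCoord y j u) := fun u =>
    marginalDensity_congr p fun i hi => by
      have hij : i ≠ j := (Fin.lt_def.2 hi).ne
      simp only [setCoord_apply, if_neg hij]
      exact h i (Fin.lt_def.2 hi)
  simp only [h1, h2]

theorem marginalDensity_setCoord (p : EuclideanSpace ℝ (Fin d) → ℝ) (j : Fin d)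
    (x : EuclideanSpace ℝ (Fin d)) (u : ℝ) :
    marginalDensity p j.val (setCoord x j u) = marginalDensity p j.val x :=
  marginalDensity_congr p fun i hi => by
    rw [setCoord_apply, if_neg (Fin.lt_def.2 hi).ne]

/-- The average of the marginal density of the first `j` coordinates, and the `j`-th one, along
the `j`-th coordinate direction from `0` to `x j`. -/
def scaledMarginal (p : EuclideanSpace ℝ (Fin d) → ℝ) (j : Fin d)
    (x : EuclideanSpace ℝ (Fin d)) : ℝ :=
  ∫ t in unitCube d, p (WithLp.toLp 2 fun i =>
    if i < j then x i else if i = j then t i * x i else t i)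

variable {k : ℕ} {D : ℝ} {p : EuclideanSpace ℝ (Fin d) → ℝ}

theorem HasGeomBound.marginalDensity (hD : 0 ≤ D) (hp : HasGeomBound k D (unitCube d) p) (m : ℕ) :
    HasGeomBound k D (unitCube d) (marginalDensity p m) := by
  have h := hp.setIntegral_diag hD (c := fun _ i => if i.val < m then 1 else 0)
    (b := fun t i => if i.val < m then 0 else t i) (fun i => continuous_const)
    (fun i => by dsimp only; split_ifs <;> fun_prop) (fun t _ i => by split_ifs <;> simp)
    (fun t ht x hx i => by dsimp only; split_ifs <;> simp [hx i, ht i, -mem_Icc])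
  convert h using 1
  ext x
  unfold _root_.marginalDensity
  congr! 5 with t
  split_ifs <;> simp

theorem HasGeomBound.scaledMarginal (hD : 0 ≤ D) (hp : HasGeomBound k D (unitCube d) p)
    (j : Fin d) : HasGeomBound k D (unitCube d) (scaledMarginal p j) := by
  have h := hp.setIntegral_diag hD
    (c := fun t i => if i < j then 1 else if i = j then t i else 0)
    (b := fun t i => if i < j then 0 else if i = j then 0 else t i)
    (fun i => by dsimp only; split_ifs <;> fun_prop)
    (fun i => by dsimp only; split_ifs <;> fun_prop)
    (fun t ht i => by
      dsimp only
      have := ht i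
      split_ifs <;> simp [abs_of_nonneg this.1, this.2])
    (fun t ht x hx i => by
      have h1 := ht i
      have h2 := hx i
      dsimp only
      split_ifs
      · simpa using h2
      · rw [add_zero]
        exact ⟨mul_nonneg h1.1 h2.1, mul_le_one₀ h1.2 h2.1 h2.2⟩
      · simpa using h1)
  convert h using 1
  ext x
  unfold _root_.scaledMarginal
  congr! 5 with t
  split_ifs <;> simp

theorem continuousOn_marginalDensity (hp : ContinuousOn p (unitCube d)) (m : ℕ) :
    ContinuousOn (marginalDensity p m) (unitCube d) := by
  obtain ⟨C, hC⟩ := (isCompact_unitCube d).exists_bound_of_continuousOn hp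
  have h : HasGeomBound 0 (max C 0) (unitCube d) p := ⟨by simpa using hp, fun i hi x hx => by
    obtain rfl : i = 0 := by omega
    simpa using Or.inl (hC x hx)⟩
  exact (h.marginalDensity (le_max_right _ _) m).contDiffOn.continuousOn

/-- Substituting `u = s v` moves the variable endpoint into the integrand. The marginal does not
involve `t j`, so `v` can take its place and the double integral becomes one over the cube. -/
theorem intervalIntegral_marginalDensity_setCoord (hp : ContinuousOn p (unitCube d)) (j : Fin d)
    {x : EuclideanSpace ℝ (Fin d)} (hx : x ∈ unitCube d) {s : ℝ} (hs : s ∈ Icc (0 : ℝ) 1) :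
    ∫ u in (0 : ℝ)..s, marginalDensity p (j.val + 1) (setCoord x j u)
      = s * scaledMarginal p j (setCoord x j s) := by
  have h1 := intervalIntegral.smul_integral_comp_mul_left (a := 0) (b := 1)
    (fun u => marginalDensity p (j.val + 1) (setCoord x j u)) s
  rw [mul_zero, mul_one] at h1
  rw [← h1, smul_eq_mul]
  congr 1
  set a : EuclideanSpace ℝ (Fin d) → EuclideanSpace ℝ (Fin d) := fun t => WithLp.toLp 2 fun i =>
    if i < j then (setCoord x j s) i else if i = j then t i * (setCoord x j s) i else t i with ha
  have hac : Continuous a := by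
    refine (PiLp.continuous_toLp 2 _).comp (continuous_pi fun i => ?_)
    split_ifs <;> fun_prop
  have ham : MapsTo a (unitCube d) (unitCube d) := by
    intro t ht i
    have h1 := ht i
    have h2 := setCoord_mem_unitCube hx j hs i
    simp only [ha]
    split_ifs
    exacts [h2, ⟨mul_nonneg h1.1 h2.1, mul_le_one₀ h1.2 h2.1 h2.2⟩, h1]
  have h2 := integral_setCoord_unitCube j (φ := fun t => p (a t)) (hp.comp hac.continuousOn ham)
  refine Eq.trans ?_ h2
  refine intervalIntegral.integral_congr fun v _ => ?_
  unfold marginalDensity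
  congr! 3 with t
  simp only [ha]
  congr 1
  ext i
  simp only [setCoord_apply]
  rcases lt_trichotomy i j with h | h | h
  · simp [h, h.ne, Nat.lt_succ_of_lt (Fin.lt_def.1 h)]
  · subst h
    simp [mul_comm]
  · have h3 : ¬ i.val < j.val + 1 := by have := Fin.lt_def.1 h; omega
    simp [h.not_gt, h.ne', h3]

/-- This exhibits the distribution function as a product of a coordinate, an average of `p` and an
inverse marginal, each with geometric bounds. -/
theorem condCDF_eq_mul_div (hp : ContinuousOn p (unitCube d)) (j : Fin d)
    {x : EuclideanSpace ℝ (Fin d)} (hx : x ∈ unitCube d) {s : ℝ} (hs : s ∈ Icc (0 : ℝ) 1) :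
    condCDF p j x s = s * scaledMarginal p j (setCoord x j s) / marginalDensity p j x := by
  rw [← intervalIntegral_marginalDensity_setCoord hp j hx hs, ← intervalIntegral.integral_div]
  unfold condCDF condDensity
  simp only [marginalDensity_setCoord]

theorem scaledMarginal_setCoord_one (j : Fin d) (x : EuclideanSpace ℝ (Fin d)) :
    scaledMarginal p j (setCoord x j 1) = marginalDensity p j x := by
  unfold scaledMarginal marginalDensity
  congr! 4 with t
  ext i
  simp only [setCoord_apply]
  rcases lt_trichotomy i j with h | h | h
  · simp [h, h.ne]
  · subst h
    simp
  · have h3 : ¬ i.val < j.val := by have := Fin.lt_def.1 h; omega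
    simp [h.not_gt, h.ne', h3]

theorem condCDF_zero (j : Fin d) (x : EuclideanSpace ℝ (Fin d)) : condCDF p j x 0 = 0 :=
  intervalIntegral.integral_same

theorem marginalDensity_mem_Icc {L₁ L₂ : ℝ} (hp : ContinuousOn p (unitCube d))
    (h : ∀ x ∈ unitCube d, p x ∈ Icc L₂ L₁) (m : ℕ) {x : EuclideanSpace ℝ (Fin d)}
    (hx : x ∈ unitCube d) : marginalDensity p m x ∈ Icc L₂ L₁ := by
  have hmaps : MapsTo (fun t : EuclideanSpace ℝ (Fin d) =>
      (WithLp.toLp 2 fun i : Fin d => if i.val < m then x i else t i : EuclideanSpace ℝ (Fin d)))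
      (unitCube d) (unitCube d) := fun t ht i => by
    dsimp only
    split_ifs
    exacts [hx i, ht i]
  have hcont : Continuous (fun t : EuclideanSpace ℝ (Fin d) =>
      (WithLp.toLp 2 fun i : Fin d => if i.val < m then x i else t i :
        EuclideanSpace ℝ (Fin d))) := by
    refine (PiLp.continuous_toLp 2 _).comp (continuous_pi fun i => ?_)
    split_ifs <;> fun_prop
  have hint : IntegrableOn (fun t : EuclideanSpace ℝ (Fin d) =>
      p (WithLp.toLp 2 fun i : Fin d => if i.val < m then x i else t i)) (unitCube d) :=
    (hp.comp hcont.continuousOn hmaps).integrableOn_compact (isCompact_unitCube d)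
  have hconst : ∀ c : ℝ, ∫ _t in unitCube d, c = c := fun c => by
    rw [setIntegral_const, volume_real_unitCube, one_smul]
  have hci : ∀ c : ℝ, IntegrableOn (fun _ => c) (unitCube d) := fun c => integrable_const c
  constructor
  · rw [← hconst L₂]
    exact setIntegral_mono_on (hci _) hint (measurableSet_unitCube d) fun t ht => (h _ (hmaps ht)).1
  · rw [← hconst L₁]
    exact setIntegral_mono_on hint (hci _) (measurableSet_unitCube d) fun t ht => (h _ (hmaps ht)).2

theorem condCDF_one {L₂ : ℝ} (hL₂ : 0 < L₂) (hp : ContinuousOn p (unitCube d))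
    (h : ∀ x ∈ unitCube d, L₂ ≤ p x) (j : Fin d)
    {x : EuclideanSpace ℝ (Fin d)} (hx : x ∈ unitCube d) : condCDF p j x 1 = 1 := by
  obtain ⟨C, hC⟩ := (isCompact_unitCube d).exists_bound_of_continuousOn hp
  have hm := marginalDensity_mem_Icc hp (L₁ := C)
    (fun y hy => ⟨h y hy, (le_abs_self _).trans (hC y hy)⟩) j.val hx
  rw [condCDF_eq_mul_div hp j hx (by simp), scaledMarginal_setCoord_one, one_mul,
    div_self (hL₂.trans_le hm.1).ne']

/-- Both marginals are averages of `p`, so the conditional density is at least `L₂ / L₁`; integrate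
from `s` to `t`. -/
theorem mul_sub_le_condCDF_sub {L₁ L₂ : ℝ} (hL₂ : 0 < L₂) (hp : ContinuousOn p (unitCube d))
    (h : ∀ x ∈ unitCube d, p x ∈ Icc L₂ L₁) (j : Fin d) {x : EuclideanSpace ℝ (Fin d)}
    (hx : x ∈ unitCube d) {s t : ℝ} (hs : 0 ≤ s) (hst : s ≤ t) (ht : t ≤ 1) :
    L₂ / L₁ * (t - s) ≤ condCDF p j x t - condCDF p j x s := by
  have hc : ContinuousOn (fun u => condDensity p j (setCoord x j u)) (Icc 0 1) := by
    unfold condDensity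
    simp only [marginalDensity_setCoord]
    refine ContinuousOn.div_const ?_ _
    exact (continuousOn_marginalDensity hp _).comp (continuous_setCoord x j).continuousOn
      fun u hu => setCoord_mem_unitCube hx j hu
  have hi : ∀ a ∈ Icc (0 : ℝ) 1, ∀ b ∈ Icc (0 : ℝ) 1,
      IntervalIntegrable (fun u => condDensity p j (setCoord x j u)) volume a b :=
    fun a ha b hb => (hc.mono (uIcc_subset_Icc ha hb)).intervalIntegrable
  have hs1 : s ∈ Icc (0 : ℝ) 1 := ⟨hs, hst.trans ht⟩
  have ht1 : t ∈ Icc (0 : ℝ) 1 := ⟨hs.trans hst, ht⟩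
  unfold condCDF
  rw [intervalIntegral.integral_interval_sub_left (hi 0 (by simp) t ht1) (hi 0 (by simp) s hs1)]
  have h1 : ∫ _u in s..t, L₂ / L₁ = L₂ / L₁ * (t - s) := by
    rw [intervalIntegral.integral_const, smul_eq_mul, mul_comm]
  rw [← h1]
  refine intervalIntegral.integral_mono_on hst (by simp) (hi s hs1 t ht1) fun u hu => ?_
  have hxu := setCoord_mem_unitCube hx j (s := u) ⟨hs.trans hu.1, hu.2.trans ht⟩
  have ha := marginalDensity_mem_Icc hp h (j.val + 1) hxu
  have hb := marginalDensity_mem_Icc hp h j.val hxu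
  exact div_le_div₀ (hL₂.le.trans ha.1) ha.1 (hL₂.trans_le hb.1) hb.2

/-- The map `x ↦ (F_{p,1}(x), …, F_{p,d}(x))` of conditional distribution functions. -/
def condCDFMap (p : EuclideanSpace ℝ (Fin d) → ℝ) (x : EuclideanSpace ℝ (Fin d)) :
    EuclideanSpace ℝ (Fin d) :=
  WithLp.toLp 2 fun j => condCDF p j x (x j)

theorem HasGeomBound.pi {k : ℕ} {D : ℝ} {E : Type*} [NormedAddCommGroup E] [NormedSpace ℝ E]
    {S : Set E} (hS : UniqueDiffOn ℝ S) (hD : 0 ≤ D) {f : E → EuclideanSpace ℝ (Fin d)}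
    (hf : ∀ j, HasGeomBound k D S fun x => f x j) : HasGeomBound k (d * D) S f := by
  have h := HasGeomBound.sum hS Finset.univ hD (f := fun j x => f x j • EuclideanSpace.single j 1)
    fun j _ => (hf j).clm_comp hS
      (ContinuousLinearMap.toSpanSingleton ℝ (EuclideanSpace.single j (1 : ℝ))) (by simp)
  rw [Finset.card_univ, Fintype.card_fin] at h
  refine h.congr fun x _ => ?_
  ext i
  simp [Pi.single_apply]

theorem HasGeomBound.condCDFMap {L₂ : ℝ} (hL₂ : 0 < L₂) (hL₂1 : L₂ ≤ 1) (hD : 1 ≤ D)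
    (hp : HasGeomBound k D (unitCube d) p) (h : ∀ x ∈ unitCube d, L₂ ≤ p x) :
    HasGeomBound k (d * (2 * (2 * 1 * D) * (k.factorial * (k.factorial * L₂⁻¹) * D ^ 2)))
      (unitCube d) (condCDFMap p) := by
  have hU := uniqueDiffOn_unitCube d
  have hk1 : (1 : ℝ) ≤ k.factorial := by exact_mod_cast Nat.factorial_pos k
  have hL : 1 ≤ L₂⁻¹ := (one_le_inv₀ hL₂).2 hL₂1
  have hA : 1 ≤ k.factorial * (k.factorial * L₂⁻¹) * D ^ 2 :=
    one_le_mul_of_one_le_of_one_le (one_le_mul_of_one_le_of_one_le hk1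
      (one_le_mul_of_one_le_of_one_le hk1 hL)) (one_le_pow₀ hD)
  refine HasGeomBound.pi hU (by positivity) fun j => ?_
  have hcoord : HasGeomBound k 1 (unitCube d) (fun x : EuclideanSpace ℝ (Fin d) => x j) := by
    refine HasGeomBound.clm hU (EuclideanSpace.proj j : EuclideanSpace ℝ (Fin d) →L[ℝ] ℝ) le_rfl
      (ContinuousLinearMap.opNorm_le_bound _ zero_le_one fun x => ?_) fun x hx => ?_
    · simpa using PiLp.norm_apply_le x j
    · simpa [abs_of_nonneg (hx j).1] using (hx j).2
  have hml : ∀ x ∈ unitCube d, L₂ ≤ _root_.marginalDensity p j x := fun x hx =>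
    (marginalDensity_mem_Icc hp.contDiffOn.continuousOn (L₁ := D)
      (fun y hy => ⟨h y hy, (le_abs_self _).trans (hp.norm_le hy)⟩) j.val hx).1
  have hinv := HasGeomBound.ringInverse hU hD hL (hp.marginalDensity (zero_le_one.trans hD) j.val)
    (fun x hx => (hL₂.trans_le (hml x hx)).ne'.isUnit) (fun x hx => by
      rw [Ring.inverse_eq_inv', norm_inv, Real.norm_of_nonneg (hL₂.le.trans (hml x hx))]
      exact inv_anti₀ hL₂ (hml x hx))
  refine ((hcoord.smul hU le_rfl hD (hp.scaledMarginal (zero_le_one.trans hD) j)).smul hU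
    (by linarith) hA hinv).congr fun x hx => ?_
  simp only [_root_.condCDFMap, smul_eq_mul, Ring.inverse_eq_inv', ← div_eq_mul_inv]
  rw [condCDF_eq_mul_div hp.contDiffOn.continuousOn j hx (hx j), setCoord_self]

end Densities
end

/-! ### Triangular maps and the Knothe–Rosenblatt map -/

noncomputable section

section Triangular

variable {d : ℕ}

/-- A map of the cube whose `j`-th component depends on the first `j` coordinates only, increases
with slope at least `c` from `0` to `1` in the `j`-th one, and is Lipschitz. -/
structure IsTriangularMap (c K : ℝ) (H : EuclideanSpace ℝ (Fin d) → EuclideanSpace ℝ (Fin d)) :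
    Prop where
  congr : ∀ x ∈ unitCube d, ∀ y ∈ unitCube d, ∀ j, (∀ i ≤ j, x i = y i) → H x j = H y j
  slope : ∀ x ∈ unitCube d, ∀ j, ∀ s t : ℝ, 0 ≤ s → s ≤ t → t ≤ 1 →
    c * (t - s) ≤ H (setCoord x j t) j - H (setCoord x j s) j
  lipschitz : ∀ x ∈ unitCube d, ∀ y ∈ unitCube d, ‖H x - H y‖ ≤ K * ‖x - y‖
  zero : ∀ x ∈ unitCube d, ∀ j, H (setCoord x j 0) j = 0
  one : ∀ x ∈ unitCube d, ∀ j, H (setCoord x j 1) j = 1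

theorem abs_apply_le_norm (x : EuclideanSpace ℝ (Fin d)) (i : Fin d) : |x i| ≤ ‖x‖ := by
  simpa using PiLp.norm_apply_le x i

namespace IsTriangularMap

variable {c K : ℝ} {H : EuclideanSpace ℝ (Fin d) → EuclideanSpace ℝ (Fin d)}
  {x y : EuclideanSpace ℝ (Fin d)}

theorem continuousOn (h : IsTriangularMap c K H) : ContinuousOn H (unitCube d) := by
  have : LipschitzOnWith K.toNNReal H (unitCube d) :=
    LipschitzOnWith.of_dist_le_mul fun x hx y hy => by
      rw [dist_eq_norm, dist_eq_norm]
      exact (h.lipschitz x hx y hy).trans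
        (mul_le_mul_of_nonneg_right (Real.le_coe_toNNReal K) (norm_nonneg _))
  exact this.continuousOn

theorem mapsTo (h : IsTriangularMap c K H) (hc : 0 ≤ c) : MapsTo H (unitCube d) (unitCube d) := by
  intro x hx j
  have h0 := h.slope x hx j 0 (x j) le_rfl (hx j).1 (hx j).2
  have h1 := h.slope x hx j (x j) 1 (hx j).1 (hx j).2 le_rfl
  rw [setCoord_self, h.zero x hx] at h0
  rw [setCoord_self, h.one x hx] at h1
  have h2 : 0 ≤ c * (x j - 0) := mul_nonneg hc (by linarith [(hx j).1])
  have h3 : 0 ≤ c * (1 - x j) := mul_nonneg hc (by linarith [(hx j).2])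
  exact ⟨by linarith, by linarith⟩

theorem slope_abs (h : IsTriangularMap c K H) (hx : x ∈ unitCube d) (j : Fin d) {s t : ℝ}
    (hs : s ∈ Icc (0 : ℝ) 1) (ht : t ∈ Icc (0 : ℝ) 1) :
    c * |t - s| ≤ |H (setCoord x j t) j - H (setCoord x j s) j| := by
  rcases le_total s t with hst | hst
  · rw [abs_of_nonneg (sub_nonneg.2 hst)]
    exact (h.slope x hx j s t hs.1 hst ht.2).trans (le_abs_self _)
  · rw [abs_sub_comm, abs_sub_comm (H _ j), abs_of_nonneg (sub_nonneg.2 hst)]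
    exact (h.slope x hx j t s ht.1 hst hs.2).trans (le_abs_self _)

/-- Pass through the point `w` with the coordinates of `x` before `j` and those of `y` from `j` on.
The slope controls the step from `x` to `w` in component `j`, the Lipschitz bound the step from `w`
to `y`. -/
theorem mul_abs_sub_le (h : IsTriangularMap c K H) (hK : 0 ≤ K) (hx : x ∈ unitCube d)
    (hy : y ∈ unitCube d) (j : Fin d) :
    c * |x j - y j| ≤ |H x j - H y j| + K * ∑ i with i < j, |x i - y i| := by
  set w : EuclideanSpace ℝ (Fin d) := WithLp.toLp 2 fun i => if i < j then x i else y i with hw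
  have hwm : w ∈ unitCube d := fun i => by
    simp only [hw]
    split_ifs
    exacts [hx i, hy i]
  have h1 := h.slope_abs hx j (hy j) (hx j)
  rw [setCoord_self] at h1
  have h2 : H (setCoord x j (y j)) j = H w j := by
    refine h.congr _ (setCoord_mem_unitCube hx j (hy j)) _ hwm j fun i hi => ?_
    rw [setCoord_apply]
    rcases hi.eq_or_lt with rfl | hi
    · simp [hw]
    · simp [hw, hi, hi.ne]
  have h3 : |H w j - H y j| ≤ K * ∑ i with i < j, |x i - y i| := by
    refine (abs_apply_le_norm (H w - H y) j).trans ((h.lipschitz w hwm y hy).trans ?_)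
    refine mul_le_mul_of_nonneg_left ((norm_le_sum_abs _).trans_eq ?_) hK
    rw [Finset.sum_filter]
    refine Finset.sum_congr rfl fun i _ => ?_
    by_cases hi : i < j <;> simp [hw, hi]
  rw [h2] at h1
  calc _ ≤ |H x j - H w j| := h1
    _ ≤ |H x j - H y j| + |H w j - H y j| := by
      rw [abs_sub_comm (H w j)]; exact abs_sub_le _ _ _
    _ ≤ _ := by linarith

/-- Forward substitution: the errors in earlier coordinates feed into the next one, each stage
costing a factor `(1 + d K) / c`. -/
theorem abs_sub_le_of_forall_le (h : IsTriangularMap c K H) (hc : 0 < c) (hc1 : c ≤ 1)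
    (hK : 0 ≤ K) (hx : x ∈ unitCube d) (hy : y ∈ unitCube d) {δ : ℝ} (hδ : 0 ≤ δ) (n : ℕ) :
    ∀ j : Fin d, j.val = n → (∀ i ≤ j, |H x i - H y i| ≤ δ) →
      |x j - y j| ≤ ((1 + d * K) / c) ^ (n + 1) * δ := by
  have hR : 1 ≤ (1 + d * K) / c := by
    rw [one_le_div hc]
    have : 0 ≤ d * K := by positivity
    linarith
  induction n using Nat.strong_induction_on with
  | _ n ih =>
    intro j hj hδj
    have h1 := h.mul_abs_sub_le hK hx hy j
    have h2 : ∑ i with i < j, |x i - y i| ≤ d * (((1 + d * K) / c) ^ n * δ) := by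
      calc _ ≤ ∑ i : Fin d with i < j, ((1 + d * K) / c) ^ n * δ := by
            refine Finset.sum_le_sum fun i hi => ?_
            have hij : i < j := by simpa using hi
            refine (ih i.val (by rw [← hj]; exact hij) i rfl
              fun l hl => hδj l (hl.trans hij.le)).trans ?_
            refine mul_le_mul_of_nonneg_right (pow_le_pow_right₀ hR ?_) hδ
            have := Fin.lt_def.1 hij
            omega
        _ ≤ _ := by
            rw [Finset.sum_const, nsmul_eq_mul]
            refine mul_le_mul_of_nonneg_right ?_ (by positivity)
            exact_mod_cast (Finset.card_filter_le _ _).trans (by simp)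
    have h3 : δ ≤ ((1 + d * K) / c) ^ n * δ := le_mul_of_one_le_left hδ (one_le_pow₀ hR)
    have h4 : c * |x j - y j| ≤ (1 + d * K) * (((1 + d * K) / c) ^ n * δ) := by
      have := hδj j le_rfl
      have := mul_le_mul_of_nonneg_left h2 hK
      nlinarith
    rw [pow_succ']
    have : (1 + d * K) / c * ((1 + d * K) / c) ^ n * δ
        = (1 + d * K) * (((1 + d * K) / c) ^ n * δ) / c := by ring
    rw [this, le_div_iff₀ hc, mul_comm]
    exact h4

theorem eq_of_forall_le (h : IsTriangularMap c K H) (hc : 0 < c) (hc1 : c ≤ 1)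
    (hK : 0 ≤ K) (hx : x ∈ unitCube d) (hy : y ∈ unitCube d) {j : Fin d}
    (hj : ∀ i ≤ j, H x i = H y i) : x j = y j := by
  have := h.abs_sub_le_of_forall_le hc hc1 hK hx hy le_rfl j.val j rfl fun i hi => by
    rw [hj i hi, sub_self, abs_zero]
  rw [mul_zero] at this
  exact sub_eq_zero.1 (abs_nonpos_iff.1 this)

theorem norm_sub_le (h : IsTriangularMap c K H) (hc : 0 < c) (hc1 : c ≤ 1) (hK : 0 ≤ K)
    (hx : x ∈ unitCube d) (hy : y ∈ unitCube d) :
    ‖x - y‖ ≤ d * ((1 + d * K) / c) ^ d * ‖H x - H y‖ := by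
  have hR : 1 ≤ (1 + d * K) / c := by
    rw [one_le_div hc]
    have : 0 ≤ d * K := by positivity
    linarith
  rw [mul_assoc]
  refine norm_le_card_mul _ fun j => ?_
  refine (h.abs_sub_le_of_forall_le hc hc1 hK hx hy (norm_nonneg (H x - H y)) j.val j rfl
    fun i _ => abs_apply_le_norm (H x - H y) i).trans ?_
  exact mul_le_mul_of_nonneg_right (pow_le_pow_right₀ hR j.isLt) (norm_nonneg _)

theorem exists_setCoord_eq (h : IsTriangularMap c K H) (hx : x ∈ unitCube d) (j : Fin d) {a : ℝ}
    (ha : a ∈ Icc (0 : ℝ) 1) : ∃ s ∈ Icc (0 : ℝ) 1, H (setCoord x j s) j = a := by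
  have hc : ContinuousOn (fun s => H (setCoord x j s) j) (Icc 0 1) :=
    (EuclideanSpace.proj (𝕜 := ℝ) j).continuous.comp_continuousOn
      (h.continuousOn.comp (continuous_setCoord x j).continuousOn
        fun s hs => setCoord_mem_unitCube hx j hs)
  have := intermediate_value_Icc zero_le_one hc
  rw [h.zero x hx, h.one x hx] at this
  exact this ha

/-- Coordinates are solved for in order by the intermediate value theorem; by triangularity,
adjusting a later one leaves the earlier equations intact. -/
theorem surjOn (h : IsTriangularMap c K H) : SurjOn H (unitCube d) (unitCube d) := by
  intro y hy
  have key : ∀ m ≤ d, ∃ x ∈ unitCube d, ∀ i : Fin d, i.val < m → H x i = y i := by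
    intro m
    induction m with
    | zero => exact fun _ => ⟨y, hy, fun i hi => absurd hi (Nat.not_lt_zero _)⟩
    | succ m ih =>
      intro hm
      obtain ⟨x, hx, hxy⟩ := ih (by omega)
      obtain ⟨s, hs, hsy⟩ := h.exists_setCoord_eq hx ⟨m, hm⟩ (hy ⟨m, hm⟩)
      refine ⟨setCoord x ⟨m, hm⟩ s, setCoord_mem_unitCube hx _ hs, fun i hi => ?_⟩
      rcases Nat.lt_succ_iff_lt_or_eq.1 hi with hi | hi
      · rw [← hxy i hi]
        refine h.congr _ (setCoord_mem_unitCube hx _ hs) x hx i fun l hl => ?_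
        have hlm : l ≠ ⟨m, hm⟩ := fun hlm => by
          rw [hlm] at hl
          exact absurd (Fin.le_def.1 hl) (by simpa using hi)
        rw [setCoord_apply, if_neg hlm]
      · obtain rfl : i = ⟨m, hm⟩ := Fin.ext hi
        exact hsy
  obtain ⟨x, hx, hxy⟩ := key d le_rfl
  exact ⟨x, hx, by ext i; exact hxy i i.isLt⟩

/-- If `F ∘ T = G` with `F` and `G` triangular, then `T` is triangular. -/
theorem of_comp_eq {F G T : EuclideanSpace ℝ (Fin d) → EuclideanSpace ℝ (Fin d)} {c K : ℝ}
    (hc : 0 < c) (hc1 : c ≤ 1) (hK : 1 ≤ K) (hF : IsTriangularMap c K F)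
    (hG : IsTriangularMap c K G) (hT : MapsTo T (unitCube d) (unitCube d))
    (hFT : ∀ x ∈ unitCube d, F (T x) = G x) :
    IsTriangularMap (c / K) (d * ((1 + d * K) / c) ^ d * K) T := by
  have hK0 : 0 < K := by linarith
  have hcongr : ∀ x ∈ unitCube d, ∀ y ∈ unitCube d, ∀ j, (∀ i ≤ j, x i = y i) →
      T x j = T y j := fun x hx y hy j hxy =>
    hF.eq_of_forall_le hc hc1 hK0.le (hT hx) (hT hy) fun i hi => by
      rw [hFT x hx, hFT y hy]
      exact hG.congr x hx y hy i fun l hl => hxy l (hl.trans hi)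
  have hbdry : ∀ x ∈ unitCube d, ∀ j, ∀ s ∈ Icc (0 : ℝ) 1, ∀ a ∈ Icc (0 : ℝ) 1,
      F (setCoord (T (setCoord x j s)) j a) j = G (setCoord x j s) j →
      T (setCoord x j s) j = a := fun x hx j s hs a ha h => by
    have hm := setCoord_mem_unitCube hx j hs
    have h1 := hF.slope_abs (hT hm) j ha (hT hm j)
    rw [setCoord_self, h, hFT _ hm, sub_self, abs_zero] at h1
    have h2 : |T (setCoord x j s) j - a| ≤ 0 := nonpos_of_mul_nonpos_right h1 hc
    exact sub_eq_zero.1 (abs_nonpos_iff.1 h2)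
  refine ⟨hcongr, fun x hx j s t hs hst ht => ?_, fun x hx y hy => ?_, fun x hx j => ?_,
    fun x hx j => ?_⟩
  · have hs1 : s ∈ Icc (0 : ℝ) 1 := ⟨hs, hst.trans ht⟩
    have ht1 : t ∈ Icc (0 : ℝ) 1 := ⟨hs.trans hst, ht⟩
    have hms := setCoord_mem_unitCube hx j hs1
    have hmt := setCoord_mem_unitCube hx j ht1
    set z := T (setCoord x j s) with hz
    set z' := T (setCoord x j t) with hz'
    have hzm : z ∈ unitCube d := hT hms
    have hzm' : z' ∈ unitCube d := hT hmt
    -- `z` and `z'` agree before `j`, because the components of `T` there do not see the `j`-th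
    -- coordinate.
    have h1 : F z' j = F (setCoord z j (z' j)) j := by
      refine hF.congr _ hzm' _ (setCoord_mem_unitCube hzm j (hzm' j)) j fun i hi => ?_
      rw [setCoord_apply]
      split_ifs with hij
      · rw [hij]
      · refine hcongr _ hmt _ hms i fun l hl => ?_
        have hlj : l ≠ j := (hl.trans_lt (lt_of_le_of_ne hi hij)).ne
        simp [hlj]
    have h2 := hG.slope x hx j s t hs hst ht
    rw [← hFT _ hmt, ← hFT _ hms, ← hz, ← hz', h1] at h2
    have h3 : |F (setCoord z j (z' j)) j - F z j| ≤ K * |z' j - z j| := by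
      refine (abs_apply_le_norm (F (setCoord z j (z' j)) - F z) j).trans
        ((hF.lipschitz _ (setCoord_mem_unitCube hzm j (hzm' j)) z hzm).trans ?_)
      refine mul_le_mul_of_nonneg_left ((norm_le_sum_abs _).trans_eq ?_) hK0.le
      rw [Finset.sum_eq_single j]
      · simp
      · intro i _ hij
        simp [hij]
      · simp
    have h4 : c * (t - s) ≤ K * |z' j - z j| := h2.trans ((le_abs_self _).trans h3)
    -- The Lipschitz bound controls only `|z' j - z j|`; monotonicity of `F` fixes the sign.
    have h5 : z j ≤ z' j := by
      by_contra! hlt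
      have h6 := hF.slope z hzm j (z' j) (z j) (hzm' j).1 hlt.le (hzm j).2
      rw [setCoord_self] at h6
      have h7 : 0 ≤ c * (t - s) := mul_nonneg hc.le (by linarith)
      have h8 : 0 < c * (z j - z' j) := mul_pos hc (by linarith)
      linarith
    rw [abs_of_nonneg (by linarith)] at h4
    rw [div_mul_eq_mul_div, div_le_iff₀ hK0, mul_comm _ K]
    exact h4
  · refine (hF.norm_sub_le hc hc1 hK0.le (hT hx) (hT hy)).trans ?_
    rw [hFT x hx, hFT y hy, mul_assoc _ K]
    exact mul_le_mul_of_nonneg_left (hG.lipschitz x hx y hy) (by positivity)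
  · refine hbdry x hx j 0 (by simp) 0 (by simp) ?_
    rw [hF.zero _ (hT (setCoord_mem_unitCube hx j (by simp))), hG.zero x hx]
  · refine hbdry x hx j 1 (by simp) 1 (by simp) ?_
    rw [hF.one _ (hT (setCoord_mem_unitCube hx j (by simp))), hG.one x hx]

/-- The identity has slope `1 ≥ c` and Lipschitz constant `1 ≤ K`, so convex combinations with it
keep both constants, uniformly in `t`. -/
theorem displacement {T : EuclideanSpace ℝ (Fin d) → EuclideanSpace ℝ (Fin d)}
    (hc1 : c ≤ 1) (hK : 1 ≤ K) (hT : IsTriangularMap c K T) {t : ℝ} (ht : t ∈ Icc (0 : ℝ) 1) :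
    IsTriangularMap c K (displacement T t) := by
  have hval : ∀ x j, _root_.displacement T t x j = (1 - t) * x j + t * T x j := fun x j => by
    simp [_root_.displacement]
  have ht' : 0 ≤ 1 - t := sub_nonneg.2 ht.2
  refine ⟨fun x hx y hy j hxy => ?_, fun x hx j s u hs hsu hu => ?_, fun x hx y hy => ?_,
    fun x hx j => ?_, fun x hx j => ?_⟩
  · rw [hval, hval, hT.congr x hx y hy j hxy, hxy j le_rfl]
  · have h := mul_le_mul_of_nonneg_left (hT.slope x hx j s u hs hsu hu) ht.1
    rw [hval, hval]
    simp only [setCoord_apply, if_true]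
    have h2 : (1 - t) * (c * (u - s)) ≤ (1 - t) * (u - s) :=
      mul_le_mul_of_nonneg_left (mul_le_of_le_one_left (by linarith) hc1) ht'
    linarith
  · have heq : _root_.displacement T t x - _root_.displacement T t y
        = (1 - t) • (x - y) + t • (T x - T y) := by
      simp only [_root_.displacement, smul_sub]; abel
    rw [heq]
    refine (norm_add_le _ _).trans ?_
    rw [norm_smul, norm_smul, Real.norm_of_nonneg ht', Real.norm_of_nonneg ht.1]
    have h := mul_le_mul_of_nonneg_left (hT.lipschitz x hx y hy) ht.1
    have h2 : (1 - t) * ‖x - y‖ ≤ (1 - t) * (K * ‖x - y‖) :=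
      mul_le_mul_of_nonneg_left (le_mul_of_one_le_left (norm_nonneg _) hK) ht'
    linarith
  · rw [hval, hT.zero x hx]; simp
  · rw [hval, hT.one x hx]; simp

end IsTriangularMap

theorem HasGeomBound.norm_sub_le {E F : Type*} [NormedAddCommGroup E] [NormedSpace ℝ E]
    [NormedAddCommGroup F] [NormedSpace ℝ F] {k : ℕ} {D : ℝ} {S : Set E} {f : E → F}
    (hf : HasGeomBound k D S f) (hk : 1 ≤ k) (hS : Convex ℝ S) (hU : UniqueDiffOn ℝ S) {x y : E}
    (hx : x ∈ S) (hy : y ∈ S) : ‖f x - f y‖ ≤ D ^ 2 * ‖x - y‖ := by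
  refine hS.norm_image_sub_le_of_norm_fderivWithin_le (𝕜 := ℝ)
    (hf.contDiffOn.differentiableOn (by exact_mod_cast (by omega : k ≠ 0))) (fun z hz => ?_) hy hx
  rw [← norm_iteratedFDerivWithin_one f (hU z hz)]
  exact hf.bound 1 hk z hz

theorem isTriangularMap_condCDFMap {p : EuclideanSpace ℝ (Fin d) → ℝ} {L₁ L₂ D : ℝ} {k : ℕ}
    (hL₂ : 0 < L₂) (hk : 1 ≤ k) (hp : ContinuousOn p (unitCube d))
    (h : ∀ x ∈ unitCube d, p x ∈ Icc L₂ L₁) (hF : HasGeomBound k D (unitCube d) (condCDFMap p)) :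
    IsTriangularMap (L₂ / L₁) (D ^ 2) (condCDFMap p) := by
  have hset : ∀ x : EuclideanSpace ℝ (Fin d), ∀ j s,
      condCDFMap p (setCoord x j s) j = condCDF p j x s := fun x j s => by
    simp only [condCDFMap, setCoord_apply, if_true]
    exact congrFun (condCDF_congr p fun i hi => by simp [hi.ne]) s
  refine ⟨fun x _ y _ j hxy => ?_, fun x hx j s t hs hst ht => ?_, fun x hx y hy => ?_,
    fun x hx j => ?_, fun x hx j => ?_⟩
  · simp only [condCDFMap]
    rw [hxy j le_rfl, condCDF_congr p fun i hi => hxy i hi.le]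
  · rw [hset, hset]
    exact mul_sub_le_condCDF_sub hL₂ hp h j hx hs hst ht
  · exact hF.norm_sub_le hk (convex_unitCube d) (uniqueDiffOn_unitCube d) hx hy
  · rw [hset, condCDF_zero]
  · rw [hset, condCDF_one hL₂ hp (fun x hx => (h x hx).1) j hx]

/-- Each value of `Function.invFunOn` is a genuine preimage by the intermediate value theorem, and
the equations already solved survive by triangularity. At `m = d` this gives `F_q (T x) = F_p x`. -/
theorem knotheRosenblattAux_spec {p q : EuclideanSpace ℝ (Fin d) → ℝ} {c K : ℝ} (hc : 0 ≤ c)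
    (hp : IsTriangularMap c K (condCDFMap p)) (hq : IsTriangularMap c K (condCDFMap q))
    {x : EuclideanSpace ℝ (Fin d)} (hx : x ∈ unitCube d) (m : ℕ) :
    knotheRosenblattAux p q x m ∈ unitCube d ∧ ∀ i : Fin d, i.val < m →
      condCDFMap q (knotheRosenblattAux p q x m) i = condCDFMap p x i := by
  induction m with
  | zero => exact ⟨fun i => by simp [knotheRosenblattAux], fun i hi => absurd hi (Nat.not_lt_zero _)⟩
  | succ m ih =>
    obtain ⟨hz, hzi⟩ := ih
    rw [knotheRosenblattAux]
    split_ifs with hm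
    · set z := knotheRosenblattAux p q x m with hzdef
      have hset : ∀ s, condCDFMap q (setCoord z ⟨m, hm⟩ s) ⟨m, hm⟩ = condCDF q ⟨m, hm⟩ z s := by
        intro s
        simp only [condCDFMap, setCoord_apply, if_true]
        exact congrFun (condCDF_congr q fun i hi => by simp [hi.ne]) s
      have hex : ∃ s ∈ Icc (0 : ℝ) 1,
          condCDF q ⟨m, hm⟩ z s = condCDF p ⟨m, hm⟩ x (x ⟨m, hm⟩) := by
        obtain ⟨s, hs, h⟩ := hq.exists_setCoord_eq hz ⟨m, hm⟩ (hp.mapsTo hc hx ⟨m, hm⟩)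
        exact ⟨s, hs, by rw [← hset, h]; rfl⟩
      have h1 := Function.invFunOn_mem hex
      have h2 := Function.invFunOn_eq hex
      set v := Function.invFunOn (condCDF q ⟨m, hm⟩ z) (Icc 0 1)
        (condCDF p ⟨m, hm⟩ x (x ⟨m, hm⟩))
      refine ⟨setCoord_mem_unitCube hz _ h1, fun i hi => ?_⟩
      rcases Nat.lt_succ_iff_lt_or_eq.1 hi with hi | hi
      · rw [← hzi i hi]
        refine hq.congr _ (setCoord_mem_unitCube hz _ h1) z hz i fun l hl => ?_
        have hlm : l ≠ ⟨m, hm⟩ := fun hlm => by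
          rw [hlm] at hl
          exact absurd (Fin.le_def.1 hl) (by simpa using hi)
        rw [setCoord_apply, if_neg hlm]
      · obtain rfl : i = ⟨m, hm⟩ := Fin.ext hi
        rw [hset, h2]
        rfl
    · exact ⟨hz, fun i _ => hzi i (by omega)⟩

theorem knotheRosenblatt_spec {p q : EuclideanSpace ℝ (Fin d) → ℝ} {c K : ℝ} (hc : 0 ≤ c)
    (hp : IsTriangularMap c K (condCDFMap p)) (hq : IsTriangularMap c K (condCDFMap q))
    {x : EuclideanSpace ℝ (Fin d)} (hx : x ∈ unitCube d) :
    knotheRosenblatt p q x ∈ unitCube d ∧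
      condCDFMap q (knotheRosenblatt p q x) = condCDFMap p x := by
  obtain ⟨h1, h2⟩ := knotheRosenblattAux_spec hc hp hq hx d
  exact ⟨h1, by ext i; exact h2 i i.isLt⟩

end Triangular
end

/-! ### All constants as powers of `Q` -/

noncomputable section

section Bounds

variable {d : ℕ}

theorem IsTriangularMap.mono {c c' K K' : ℝ}
    {H : EuclideanSpace ℝ (Fin d) → EuclideanSpace ℝ (Fin d)} (h : IsTriangularMap c K H)
    (hc : c' ≤ c) (hK : K ≤ K') : IsTriangularMap c' K' H :=
  ⟨h.congr, fun x hx j s t hs hst ht => (mul_le_mul_of_nonneg_right hc (by linarith)).trans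
    (h.slope x hx j s t hs hst ht), fun x hx y hy => (h.lipschitz x hx y hy).trans
    (mul_le_mul_of_nonneg_right hK (norm_nonneg _)), h.zero, h.one⟩

/-- `Q` dominates the combinatorial constants that occur in dimension `d` and up to order `k`. -/
structure IsLargeConst (k d : ℕ) (Q : ℝ) : Prop where
  dim : 2 * ((d : ℝ) + 1) ≤ Q
  factorial : (k.factorial : ℝ) ≤ Q

namespace IsLargeConst

variable {k : ℕ} {Q : ℝ}

theorem two_le (h : IsLargeConst k d Q) : 2 ≤ Q := by
  have := h.dim; have : (0 : ℝ) ≤ d := Nat.cast_nonneg d; linarith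

theorem one_le (h : IsLargeConst k d Q) : 1 ≤ Q := by linarith [h.two_le]

theorem pos (h : IsLargeConst k d Q) : 0 < Q := by linarith [h.two_le]

theorem nonneg (h : IsLargeConst k d Q) : 0 ≤ Q := h.pos.le

theorem dim_le (h : IsLargeConst k d Q) : (d : ℝ) + 1 ≤ Q := by
  have := h.dim; have : (0 : ℝ) ≤ d := Nat.cast_nonneg d; linarith

theorem dim_le' (h : IsLargeConst k d Q) : (d : ℝ) ≤ Q := by linarith [h.dim_le]

theorem pow_le (h : IsLargeConst k d Q) {m n : ℕ} (hmn : m ≤ n) : Q ^ m ≤ Q ^ n :=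
  pow_le_pow_right₀ h.one_le hmn

theorem one_le_pow (h : IsLargeConst k d Q) (n : ℕ) : 1 ≤ Q ^ n := one_le_pow₀ h.one_le

theorem le_pow (h : IsLargeConst k d Q) {n : ℕ} (hn : n ≠ 0) : Q ≤ Q ^ n :=
  le_self_pow₀ h.one_le hn

theorem pow_add_pow_le (h : IsLargeConst k d Q) {m n : ℕ} (hmn : m ≤ n) :
    Q ^ m + Q ^ n ≤ Q ^ (n + 1) := by
  have h1 := h.pow_le hmn
  have h2 := mul_le_mul_of_nonneg_right h.two_le (pow_nonneg h.nonneg n)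
  rw [pow_succ']
  linarith

theorem expansion_le (h : IsLargeConst k d Q) (a b : ℕ) :
    d * ((1 + d * Q ^ b) / (Q ^ a)⁻¹) ^ d ≤ Q ^ (1 + (a + b + 1) * d) := by
  have hQ := h.nonneg
  have h1 : (1 + d * Q ^ b) / (Q ^ a)⁻¹ ≤ Q ^ (a + b + 1) := by
    rw [div_inv_eq_mul]
    have h2 : 1 + d * Q ^ b ≤ Q * Q ^ b := by
      have := mul_le_mul_of_nonneg_right h.dim_le (pow_nonneg hQ b)
      have := h.one_le_pow b
      linarith
    calc _ ≤ Q * Q ^ b * Q ^ a := by gcongr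
      _ = _ := by ring
  calc _ ≤ Q * (Q ^ (a + b + 1)) ^ d := by
        gcongr
        exact h.dim_le'
    _ = _ := by rw [← pow_mul]; ring

/-- Here the powers of `k` arise: each inversion multiplies the exponent by a multiple of `k + 1`.
-/
theorem inverse_le (h : IsLargeConst (k + 1) d Q) {r : ℝ} (hr : 0 ≤ r) {e a : ℕ} (hre : r ≤ Q ^ e) :
    k.factorial * (k.factorial * (k.factorial * r) * ((Q ^ a) ^ 2) ^ 2) ^ (k + 1)
      ≤ Q ^ (1 + (2 + e + 4 * a) * (k + 1)) := by
  have hk : (k.factorial : ℝ) ≤ Q :=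
    le_trans (by exact_mod_cast Nat.factorial_le k.le_succ) h.factorial
  have hQ := h.nonneg
  calc _ ≤ Q * (Q * (Q * Q ^ e) * ((Q ^ a) ^ 2) ^ 2) ^ (k + 1) := by gcongr
    _ = Q ^ (1 + (2 + e + 4 * a) * (k + 1)) := by
      have h1 : Q * (Q * Q ^ e) * ((Q ^ a) ^ 2) ^ 2 = Q ^ (2 + e + 4 * a) := by ring
      rw [h1, ← pow_mul, ← pow_succ', add_comm 1]

end IsLargeConst

variable {k : ℕ} {Q L₁ L₂ : ℝ} {p q : EuclideanSpace ℝ (Fin d) → ℝ}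

/-- A density with `C^k` norm at most `Q` that takes values in `[L₂, L₁]`. -/
structure IsBoundedDensity (k : ℕ) (Q L₁ L₂ : ℝ) (p : EuclideanSpace ℝ (Fin d) → ℝ) : Prop where
  geom : HasGeomBound k Q (unitCube d) p
  mem : ∀ x ∈ unitCube d, p x ∈ Icc L₂ L₁
  pos : 0 < L₂
  le_one : L₂ ≤ 1
  inv_le : L₂⁻¹ ≤ Q
  ratio_le : L₁ / L₂ ≤ Q

theorem IsBoundedDensity.geom_condCDFMap (h : IsLargeConst k d Q)
    (hp : IsBoundedDensity k Q L₁ L₂ p) : HasGeomBound k (Q ^ 9) (unitCube d) (condCDFMap p) := by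
  have hQ := h.nonneg
  have hinv : 0 ≤ L₂⁻¹ := inv_nonneg.2 hp.pos.le
  refine (hp.geom.condCDFMap hp.pos hp.le_one h.one_le fun x hx => (hp.mem x hx).1).mono
    (by positivity) ?_
  calc _ ≤ Q * (Q * (Q * 1 * Q) * (Q * (Q * Q) * Q ^ 2)) := by
        gcongr
        exacts [h.dim_le', h.two_le, h.two_le, h.factorial, h.factorial, hp.inv_le]
    _ = Q ^ 9 := by ring

/-- The Lipschitz constant is the first-derivative bound `(Q^9)^2`, and the slope is `L₂ / L₁ ≥ 1 /
Q`. -/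
theorem IsBoundedDensity.isTriangularMap (h : IsLargeConst k d Q) (hk : 1 ≤ k)
    (hp : IsBoundedDensity k Q L₁ L₂ p) :
    IsTriangularMap (Q ^ 1)⁻¹ (Q ^ 18) (condCDFMap p) := by
  have h1 := isTriangularMap_condCDFMap hp.pos hk hp.geom.contDiffOn.continuousOn hp.mem
    (hp.geom_condCDFMap h)
  refine h1.mono ?_ (by rw [← pow_mul])
  have h0 := hp.mem 0 fun i => by simp
  have hL₁ : 0 < L₁ := hp.pos.trans_le (h0.1.trans h0.2)
  rw [pow_one, inv_le_comm₀ h.pos (div_pos hp.pos hL₁), inv_div]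
  exact hp.ratio_le

theorem IsBoundedDensity.isTriangularMap_knotheRosenblatt (h : IsLargeConst k d Q) (hk : 1 ≤ k)
    (hp : IsBoundedDensity k Q L₁ L₂ p) (hq : IsBoundedDensity k Q L₁ L₂ q) :
    IsTriangularMap (Q ^ 19)⁻¹ (Q ^ (19 + 20 * d)) (knotheRosenblatt p q) := by
  have hQ := h.nonneg
  have hc : 0 < (Q ^ 1)⁻¹ := inv_pos.2 (pow_pos h.pos 1)
  have hFp := hp.isTriangularMap h hk
  have hFq := hq.isTriangularMap h hk
  refine (IsTriangularMap.of_comp_eq hc (inv_le_one_of_one_le₀ (h.one_le_pow 1))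
    (h.one_le_pow 18) hFq hFp (fun x hx => (knotheRosenblatt_spec hc.le hFp hFq hx).1)
    fun x hx => (knotheRosenblatt_spec hc.le hFp hFq hx).2).mono ?_ ?_
  · rw [div_eq_mul_inv, ← mul_inv, ← pow_add]
  · calc _ ≤ Q ^ (1 + (1 + 18 + 1) * d) * Q ^ 18 := by
          gcongr
          exact h.expansion_le 1 18
      _ = _ := by rw [← pow_add]; ring_nf

theorem IsBoundedDensity.geom_knotheRosenblatt (h : IsLargeConst (k + 1) d Q)
    (hp : IsBoundedDensity (k + 1) Q L₁ L₂ p) (hq : IsBoundedDensity (k + 1) Q L₁ L₂ q) :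
    HasGeomBound (k + 1) (Q ^ ((59 + 20 * d) * (k + 1))) (unitCube d) (knotheRosenblatt p q) := by
  have hQ := h.nonneg
  have hU := uniqueDiffOn_unitCube d
  have hc : 0 < (Q ^ 1)⁻¹ := inv_pos.2 (pow_pos h.pos 1)
  have hFp := hp.isTriangularMap h (by omega)
  have hFq := hq.isTriangularMap h (by omega)
  have hspec := fun x hx => knotheRosenblatt_spec hc.le hFp hFq (x := x) hx
  set G := Function.invFunOn (condCDFMap q) (unitCube d) with hG
  have hGS : MapsTo G (unitCube d) (unitCube d) := fun y hy =>
    Function.invFunOn_mem (hFq.surjOn hy)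
  have hHG : ∀ y ∈ unitCube d, condCDFMap q (G y) = y := fun y hy =>
    Function.invFunOn_eq (hFq.surjOn hy)
  have hanti : ∀ x ∈ unitCube d, ∀ y ∈ unitCube d,
      ‖x - y‖ ≤ Q ^ (1 + 20 * d) * ‖condCDFMap q x - condCDFMap q y‖ := fun x hx y hy =>
    (hFq.norm_sub_le hc (inv_le_one_of_one_le₀ (h.one_le_pow 1)) (pow_nonneg hQ 18) hx hy).trans
      (mul_le_mul_of_nonneg_right (h.expansion_le 1 18) (norm_nonneg _))
  have hGb := (HasGeomBound.inverse (convex_unitCube d) (isClosed_unitCube d)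
    (nonempty_interior_unitCube d) (h.one_le_pow 9) (h.one_le_pow _) (hq.geom_condCDFMap h) hGS hHG
    hanti fun x hx => (norm_le_of_mem_unitCube hx).trans
      (h.dim_le'.trans (h.le_pow (by norm_num)))).mono (by positivity)
    (h.inverse_le (pow_nonneg hQ _) le_rfl)
  have hcomp := (hGb.comp hU hU (h.one_le_pow _) (h.one_le_pow 9) (hp.geom_condCDFMap h)
    (hFp.mapsTo hc.le)).mono (D₂ := Q ^ ((59 + 20 * d) * (k + 1))) (by positivity) ?_
  · refine hcomp.congr fun x hx => ?_
    obtain ⟨h1, h2⟩ := hspec x hx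
    -- `T x` and `G (F_p x)` have the same image under `F_q`, so expansion identifies them.
    have h3 := hanti _ h1 _ (hGS (hFp.mapsTo hc.le hx))
    rw [hHG _ (hFp.mapsTo hc.le hx), h2, sub_self, norm_zero, mul_zero] at h3
    exact sub_eq_zero.1 (norm_le_zero_iff.1 h3)
  · calc _ ≤ Q * Q ^ (1 + (2 + (1 + 20 * d) + 4 * 9) * (k + 1)) * (Q ^ 9) ^ 2 := by
          gcongr
          exact h.factorial
      _ = Q ^ (20 + (39 + 20 * d) * (k + 1)) := by rw [← pow_mul, ← pow_succ', ← pow_add]; ring_nf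
      _ ≤ _ := h.pow_le (by nlinarith)

end Bounds

/-! ### The space-time flow and its velocity field -/

section Velocity

variable {d : ℕ}

/-- The flow of the displacement interpolation, together with the time variable. -/
def displacementFlow (T : EuclideanSpace ℝ (Fin d) → EuclideanSpace ℝ (Fin d))
    (z : WithLp 2 (EuclideanSpace ℝ (Fin d) × ℝ)) : WithLp 2 (EuclideanSpace ℝ (Fin d) × ℝ) :=
  WithLp.toLp 2 (displacement T z.snd z.fst, z.snd)

/-- The linear inclusion `x ↦ (x, 0)`. -/
def inlL2 (d : ℕ) : EuclideanSpace ℝ (Fin d) →L[ℝ] WithLp 2 (EuclideanSpace ℝ (Fin d) × ℝ) :=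
  ((WithLp.prodContinuousLinearEquiv 2 ℝ (EuclideanSpace ℝ (Fin d)) ℝ).symm :
    EuclideanSpace ℝ (Fin d) × ℝ →L[ℝ] WithLp 2 (EuclideanSpace ℝ (Fin d) × ℝ)).comp
    (ContinuousLinearMap.inl ℝ (EuclideanSpace ℝ (Fin d)) ℝ)

theorem inlL2_apply (x : EuclideanSpace ℝ (Fin d)) : inlL2 d x = WithLp.toLp 2 (x, (0 : ℝ)) := rfl

theorem norm_inlL2_le : ‖inlL2 d‖ ≤ 1 :=
  ContinuousLinearMap.opNorm_le_bound _ zero_le_one fun x => by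
    rw [inlL2_apply, one_mul]
    exact (WithLp.norm_toLp_fst 2 _ _ x).le

theorem norm_fstL_le : ‖WithLp.fstL 2 ℝ (EuclideanSpace ℝ (Fin d)) ℝ‖ ≤ 1 :=
  ContinuousLinearMap.opNorm_le_bound _ zero_le_one fun z => by
    rw [one_mul]; exact norm_fst_le_norm z

theorem norm_sndL_le : ‖WithLp.sndL 2 ℝ (EuclideanSpace ℝ (Fin d)) ℝ‖ ≤ 1 :=
  ContinuousLinearMap.opNorm_le_bound _ zero_le_one fun z => by
    rw [one_mul]; exact norm_snd_le_norm z

variable {c K : ℝ} {T : EuclideanSpace ℝ (Fin d) → EuclideanSpace ℝ (Fin d)}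

theorem surjOn_displacementFlow (hc1 : c ≤ 1) (hK : 1 ≤ K) (hT : IsTriangularMap c K T) :
    SurjOn (displacementFlow T) (unitCylinder d) (unitCylinder d) := by
  rintro z ⟨hz1, hz2⟩
  obtain ⟨x, hx, hxz⟩ := (hT.displacement hc1 hK hz2).surjOn hz1
  refine ⟨WithLp.toLp 2 (x, z.snd), ⟨hx, hz2⟩, ?_⟩
  unfold displacementFlow
  dsimp only [WithLp.toLp_fst, WithLp.toLp_snd]
  rw [hxz]
  rfl

/-- Compare the spatial points at the common time `z.snd`, where expansion applies; moving `w` to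
that time displaces its image by at most `|z.snd - w.snd| * d`, since `‖T - id‖ ≤ d` on the cube. -/
theorem norm_sub_le_displacementFlow {r : ℝ} (hr : 0 ≤ r)
    (hmaps : MapsTo T (unitCube d) (unitCube d))
    (hT : ∀ t ∈ Icc (0 : ℝ) 1, ∀ x ∈ unitCube d, ∀ y ∈ unitCube d,
      ‖x - y‖ ≤ r * ‖displacement T t x - displacement T t y‖)
    {z w : WithLp 2 (EuclideanSpace ℝ (Fin d) × ℝ)}
    (hz : z ∈ unitCylinder d) (hw : w ∈ unitCylinder d) :
    ‖z - w‖ ≤ (r * (1 + d) + 1) * ‖displacementFlow T z - displacementFlow T w‖ := by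
  have h1 := hT z.snd hz.2 z.fst hz.1 w.fst hw.1
  have h2 : ‖displacement T z.snd z.fst - displacement T w.snd w.fst‖
      ≤ ‖displacementFlow T z - displacementFlow T w‖ :=
    norm_fst_le_norm (displacementFlow T z - displacementFlow T w)
  have h3 : |z.snd - w.snd| ≤ ‖displacementFlow T z - displacementFlow T w‖ :=
    norm_snd_le_norm (displacementFlow T z - displacementFlow T w)
  have h4 : ‖z - w‖ ≤ ‖z.fst - w.fst‖ + |z.snd - w.snd| :=
    norm_le_norm_fst_add_norm_snd (z - w)
  have h5 : displacement T z.snd z.fst - displacement T z.snd w.fst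
      = (displacement T z.snd z.fst - displacement T w.snd w.fst)
        - (z.snd - w.snd) • (T w.fst - w.fst) := by
    simp only [displacement]
    module
  have h6 : ‖T w.fst - w.fst‖ ≤ d := by
    have h := norm_le_card_mul (c := 1) (T w.fst - w.fst) fun i => by
      have ha := hmaps hw.1 i
      have hb := hw.1 i
      rw [PiLp.sub_apply, abs_le]
      exact ⟨by linarith [ha.1, hb.2], by linarith [ha.2, hb.1]⟩
    simpa using h
  have h7 : ‖displacement T z.snd z.fst - displacement T z.snd w.fst‖
      ≤ ‖displacementFlow T z - displacementFlow T w‖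
        + ‖displacementFlow T z - displacementFlow T w‖ * d := by
    rw [h5]
    refine (norm_sub_le _ _).trans (add_le_add h2 ?_)
    rw [norm_smul, Real.norm_eq_abs]
    exact mul_le_mul h3 h6 (norm_nonneg _) (norm_nonneg _)
  have h8 := mul_le_mul_of_nonneg_left h7 hr
  calc _ ≤ _ := h4
    _ ≤ r * (‖displacementFlow T z - displacementFlow T w‖
        + ‖displacementFlow T z - displacementFlow T w‖ * d)
        + ‖displacementFlow T z - displacementFlow T w‖ := add_le_add (h1.trans h8) h3
    _ = _ := by ring

theorem hasDerivWithinAt_displacement (T : EuclideanSpace ℝ (Fin d) → EuclideanSpace ℝ (Fin d))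
    (x : EuclideanSpace ℝ (Fin d)) (t : ℝ) (S : Set ℝ) :
    HasDerivWithinAt (fun s => displacement T s x) (T x - x) S t := by
  have h : HasDerivAt (fun s : ℝ => x + s • (T x - x)) ((1 : ℝ) • (T x - x)) t :=
    ((hasDerivAt_id t).smul_const (T x - x)).const_add x
  rw [one_smul] at h
  refine h.hasDerivWithinAt.congr_of_eventuallyEq (Filter.Eventually.of_forall fun s => ?_) ?_ <;>
  · simp only [displacement]
    module

/-- The path has constant velocity `T x - x`, and derivatives within `[0,1]` are unique. The
differential equation thus becomes an algebraic equation along the flow. -/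
theorem isStraightLineVelocity_iff
    {f : WithLp 2 (EuclideanSpace ℝ (Fin d) × ℝ) → EuclideanSpace ℝ (Fin d)} :
    IsStraightLineVelocity T f ↔
      ∀ z ∈ unitCylinder d, f (displacementFlow T z) = T z.fst - z.fst := by
  constructor
  · rintro h z ⟨hz1, hz2⟩
    have hU : UniqueDiffWithinAt ℝ (Icc (0 : ℝ) 1) z.snd := uniqueDiffOn_Icc zero_lt_one _ hz2
    exact hU.eq_deriv _ (h z.fst hz1 z.snd hz2) (hasDerivWithinAt_displacement T z.fst z.snd _)
  · intro h x hx t ht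
    have h1 := h (WithLp.toLp 2 (x, t)) ⟨hx, ht⟩
    have h2 : f (WithLp.toLp 2 (displacement T t x, t)) = T x - x := h1
    rw [h2]
    exact hasDerivWithinAt_displacement T x t _

variable {k : ℕ} {Q : ℝ}

theorem HasGeomBound.displacementFlow (h : IsLargeConst k d Q) {a : ℕ}
    (hT : HasGeomBound k (Q ^ a) (unitCube d) T) :
    HasGeomBound k (Q ^ (a + 7)) (unitCylinder d) (displacementFlow T) := by
  have hQ := h.nonneg
  have hU := uniqueDiffOn_unitCylinder d
  have hfst : HasGeomBound k Q (unitCylinder d) (WithLp.fstL 2 ℝ (EuclideanSpace ℝ (Fin d)) ℝ) :=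
    HasGeomBound.clm hU _ h.one_le (norm_fstL_le.trans h.one_le)
      fun z hz => (norm_le_of_mem_unitCube hz.1).trans h.dim_le'
  have hsnd : HasGeomBound k Q (unitCylinder d) (WithLp.sndL 2 ℝ (EuclideanSpace ℝ (Fin d)) ℝ) :=
    HasGeomBound.clm hU _ h.one_le (norm_sndL_le.trans h.one_le)
      fun z hz => (abs_le.2 ⟨by linarith [hz.2.1], hz.2.2⟩ : |z.snd| ≤ 1).trans h.one_le
  have hid : HasGeomBound k Q (unitCylinder d)
      (ContinuousLinearMap.id ℝ (WithLp 2 (EuclideanSpace ℝ (Fin d) × ℝ))) :=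
    HasGeomBound.clm hU _ h.one_le (ContinuousLinearMap.norm_id_le.trans h.one_le)
      fun z hz => (norm_le_of_mem_unitCylinder hz).trans h.dim_le
  -- The flow is assembled as `(x, t) + (t (T x - x), 0)`.
  have h1 := (hT.comp hU (uniqueDiffOn_unitCube d) (h.one_le_pow a) h.one_le hfst
    fun z hz => hz.1).mono (D₂ := Q ^ (a + 3)) (by positivity) (by
      calc _ ≤ Q * Q ^ a * Q ^ 2 := by gcongr; exact h.factorial
        _ = _ := by ring)
  have h2 := (h1.add hU (by positivity) hQ (hfst.neg hU)).mono (D₂ := Q ^ (a + 4))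
    (by positivity) (by
      have := h.pow_add_pow_le (m := 1) (n := a + 3) (by omega)
      rw [pow_one] at this
      linarith)
  have h3 := (hsnd.smul hU h.one_le (h.one_le_pow _) h2).mono (D₂ := Q ^ (a + 6))
    (by positivity) (by
      calc _ ≤ Q * Q * Q ^ (a + 4) := by gcongr; exact h.two_le
        _ = _ := by ring)
  have h4 := (hid.add hU hQ (by positivity) (h3.clm_comp hU (inlL2 d) norm_inlL2_le)).mono
    (D₂ := Q ^ (a + 7)) (by positivity) (by
      have := h.pow_add_pow_le (m := 1) (n := a + 6) (by omega)
      rwa [pow_one] at this)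
  refine h4.congr fun z _ => ?_
  apply (WithLp.equiv 2 _).injective
  refine Prod.ext ?_ ?_
  · change displacement T z.snd z.fst = z.fst + z.snd • (T z.fst + - z.fst)
    simp only [displacement]
    module
  · change z.snd = z.snd + 0
    rw [add_zero]

theorem exists_velocity_of_isTriangularMap (h : IsLargeConst (k + 1) d Q) {a b e : ℕ}
    (hT : HasGeomBound (k + 1) (Q ^ a) (unitCube d) T)
    (hTt : IsTriangularMap (Q ^ b)⁻¹ (Q ^ e) T) :
    ∃ f : WithLp 2 (EuclideanSpace ℝ (Fin d) × ℝ) → EuclideanSpace ℝ (Fin d),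
      IsStraightLineVelocity T f ∧
      (∀ g : WithLp 2 (EuclideanSpace ℝ (Fin d) × ℝ) → EuclideanSpace ℝ (Fin d),
        IsStraightLineVelocity T g → Set.EqOn g f (unitCylinder d)) ∧
      HasGeomBound (k + 1)
        (Q ^ (a + 5 + 2 * ((2 + (2 + (b + e + 1) * d) + 4 * (a + 7)) * (k + 1))))
        (unitCylinder d) f := by
  have hQ := h.nonneg
  have hU := uniqueDiffOn_unitCylinder d
  have hc : 0 < (Q ^ b)⁻¹ := inv_pos.2 (pow_pos h.pos b)
  have hc1 : (Q ^ b)⁻¹ ≤ 1 := inv_le_one_of_one_le₀ (h.one_le_pow b)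
  have hK : 1 ≤ Q ^ e := h.one_le_pow e
  have hmaps := hTt.mapsTo hc.le
  have hsurj := surjOn_displacementFlow hc1 hK hTt
  set r : ℝ := Q ^ (1 + (b + e + 1) * d) with hr
  have hr1 : 1 ≤ r := h.one_le_pow _
  have hanti : ∀ z ∈ unitCylinder d, ∀ w ∈ unitCylinder d,
      ‖z - w‖ ≤ (r * (1 + d) + 1) * ‖displacementFlow T z - displacementFlow T w‖ :=
    fun z hz w hw => norm_sub_le_displacementFlow (by linarith) hmaps
      (fun t ht x hx y hy => ((hTt.displacement hc1 hK ht).norm_sub_le hc hc1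
        (by linarith) hx hy).trans
        (mul_le_mul_of_nonneg_right (h.expansion_le b e) (norm_nonneg _))) hz hw
  have hrH : r * (1 + d) + 1 ≤ Q ^ (2 + (b + e + 1) * d) := by
    have h1 := mul_le_mul_of_nonneg_left h.dim (zero_le_one.trans hr1)
    have h2 : 0 ≤ r * d := by positivity
    -- The factor `2` in `IsLargeConst.dim` absorbs the added `1`: `r (1 + d) + 1 ≤ 2 r (d + 1)`.
    calc r * (1 + d) + 1 ≤ r * Q := by nlinarith
      _ = _ := by rw [hr]; ring
  set G := Function.invFunOn (displacementFlow T) (unitCylinder d) with hG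
  have hGS : MapsTo G (unitCylinder d) (unitCylinder d) := fun y hy =>
    Function.invFunOn_mem (hsurj hy)
  have hHG : ∀ y ∈ unitCylinder d, displacementFlow T (G y) = y := fun y hy =>
    Function.invFunOn_eq (hsurj hy)
  have hflow : ∀ z ∈ unitCylinder d, displacementFlow T z ∈ unitCylinder d := fun z hz =>
    ⟨(hTt.displacement hc1 hK hz.2).mapsTo hc.le hz.1, hz.2⟩
  have hGb := (HasGeomBound.inverse (convex_unitCylinder d) (isClosed_unitCylinder d)
    (nonempty_interior_unitCylinder d) (h.one_le_pow _)
    (by have : 0 ≤ r * (1 + d) := by positivity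
        linarith) (hT.displacementFlow h) hGS hHG
    hanti fun x hx => (norm_le_of_mem_unitCylinder hx).trans
      (h.dim_le.trans (h.le_pow (by omega)))).mono (by positivity)
    (h.inverse_le (by positivity) hrH)
  have hGfst := hGb.clm_comp hU (WithLp.fstL 2 ℝ (EuclideanSpace ℝ (Fin d)) ℝ) norm_fstL_le
  have hid : HasGeomBound (k + 1) Q (unitCube d)
      (ContinuousLinearMap.id ℝ (EuclideanSpace ℝ (Fin d))) :=
    HasGeomBound.clm (uniqueDiffOn_unitCube d) _ h.one_le
      (ContinuousLinearMap.norm_id_le.trans h.one_le)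
      fun x hx => (norm_le_of_mem_unitCube hx).trans h.dim_le'
  have hTid := (hT.add (uniqueDiffOn_unitCube d) (by positivity) hQ
    (hid.neg (uniqueDiffOn_unitCube d))).mono (D₂ := Q ^ (a + 2)) (by positivity) (by
      have h1 := h.pow_le (m := a) (n := a + 1) (by omega)
      have h2 := h.pow_add_pow_le (m := 1) (n := a + 1) (by omega)
      rw [pow_one] at h2
      linarith)
  have hf := (hTid.comp hU (uniqueDiffOn_unitCube d) (h.one_le_pow _) (h.one_le_pow _) hGfst
    fun z hz => (hGS hz).1)
  have hGH : ∀ z ∈ unitCylinder d, G (displacementFlow T z) = z := fun z hz => by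
    have h3 := hanti _ (hGS (hflow z hz)) _ hz
    rw [hHG _ (hflow z hz), sub_self, norm_zero, mul_zero] at h3
    exact sub_eq_zero.1 (norm_le_zero_iff.1 h3)
  refine ⟨fun z => T (G z).fst - (G z).fst, ?_, fun g hg z hz => ?_, ?_⟩
  · rw [isStraightLineVelocity_iff]
    intro z hz
    rw [hGH z hz]
  · have h1 := isStraightLineVelocity_iff.1 hg (G z) (hGS hz)
    rwa [hHG z hz] at h1
  · refine (hf.mono (by positivity) ?_).congr fun z _ => ?_
    · calc _ ≤ Q * Q ^ (a + 2) *
          (Q ^ (1 + (2 + (2 + (b + e + 1) * d) + 4 * (a + 7)) * (k + 1))) ^ 2 := by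
            gcongr
            exact h.factorial
        _ = _ := by rw [← pow_mul, ← pow_succ', ← pow_add]; ring_nf
    · exact sub_eq_add_neg _ _

end Velocity
end

/-! ### From the stated norms to the final exponent -/

theorem norm_iteratedFDerivWithin_le_of_ckENorm_le {E F : Type*} [NormedAddCommGroup E]
    [NormedSpace ℝ E] [NormedAddCommGroup F] [NormedSpace ℝ F] {k : ℕ} {S : Set E} {f : E → F}
    {L : ℝ} (h : ckENorm k S f ≤ ENNReal.ofReal L) {n : ℕ} (hn : n ≤ k) {x : E} (hx : x ∈ S) :
    ‖iteratedFDerivWithin ℝ n f S x‖ ≤ max L 0 := by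
  have h1 : ‖iteratedFDerivWithin ℝ n f S x‖ₑ ≤ ENNReal.ofReal L :=
    (le_iSup₂_of_le (f := fun n (_ : n ∈ Iic k) => ⨆ x ∈ S, ‖iteratedFDerivWithin ℝ n f S x‖ₑ)
      n hn (le_iSup₂_of_le (f := fun x (_ : x ∈ S) => ‖iteratedFDerivWithin ℝ n f S x‖ₑ)
        x hx le_rfl)).trans h
  rw [← ofReal_norm] at h1
  refine (ENNReal.ofReal_le_ofReal_iff (le_max_right _ _)).1 ?_
  rw [ENNReal.ofReal_max]
  exact le_max_of_le_left h1

theorem ckENorm_le_ofReal {E F : Type*} [NormedAddCommGroup E]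
    [NormedSpace ℝ E] [NormedAddCommGroup F] [NormedSpace ℝ F] {k : ℕ} {S : Set E} {f : E → F}
    {L : ℝ} (h : ∀ n ≤ k, ∀ x ∈ S, ‖iteratedFDerivWithin ℝ n f S x‖ ≤ L) :
    ckENorm k S f ≤ ENNReal.ofReal L := by
  refine iSup₂_le fun n hn => iSup₂_le fun x hx => ?_
  rw [← ofReal_norm]
  exact ENNReal.ofReal_le_ofReal (h n hn x hx)

/-- The total mass `1` is the marginal of order `0`, an average of values of `p`, so it lies between
`L₂` and `L₁`. -/
theorem IsRegularDensity.le_one_le {d k : ℕ} {L₁ L₂ : ℝ} {p : EuclideanSpace ℝ (Fin d) → ℝ}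
    (hL₂ : 0 < L₂) (hp : IsRegularDensity k L₁ L₂ p) :
    (∀ x ∈ unitCube d, p x ∈ Icc L₂ L₁) ∧ L₂ ≤ 1 ∧ 1 ≤ L₁ := by
  have hmem : ∀ x ∈ unitCube d, p x ∈ Icc L₂ L₁ := fun x hx => by
    have h1 := norm_iteratedFDerivWithin_le_of_ckENorm_le hp.norm_le (Nat.zero_le k) hx
    rw [norm_iteratedFDerivWithin_zero] at h1
    have h2 := hp.le x hx
    have h3 := (le_abs_self (p x)).trans h1
    refine ⟨h2, ?_⟩
    rcases le_max_iff.1 h3 with h | h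
    exacts [h, absurd (hL₂.trans_le h2) (not_lt.2 h)]
  have h := marginalDensity_mem_Icc hp.contDiffOn.continuousOn hmem 0
    (x := (0 : EuclideanSpace ℝ (Fin d))) fun i => by simp
  have h0 : marginalDensity p 0 (0 : EuclideanSpace ℝ (Fin d)) = 1 := by
    rw [← hp.integral_eq_one]
    unfold marginalDensity
    congr! 3 with t
  rw [h0] at h
  exact ⟨hmem, h.1, h.2⟩

theorem IsRegularDensity.isBoundedDensity {d k : ℕ} {L₁ L₂ c : ℝ}
    {p : EuclideanSpace ℝ (Fin d) → ℝ} (hL₂ : 0 < L₂) (hc : 1 ≤ c)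
    (hp : IsRegularDensity k L₁ L₂ p) : IsBoundedDensity k (c * (L₁ / L₂)) L₁ L₂ p := by
  obtain ⟨hmem, h2, h1⟩ := hp.le_one_le hL₂
  have hle : L₁ / L₂ ≤ c * (L₁ / L₂) := le_mul_of_one_le_left (by positivity) hc
  have hL₁ : L₁ ≤ L₁ / L₂ := by
    rw [le_div_iff₀ hL₂]; exact mul_le_of_le_one_right (by linarith) h2
  have hinv : L₂⁻¹ ≤ L₁ / L₂ := by
    rw [div_eq_mul_inv]; exact le_mul_of_one_le_left (inv_nonneg.2 hL₂.le) h1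
  refine ⟨⟨hp.contDiffOn, fun i hi x hx => ?_⟩, hmem, hL₂, h2, hinv.trans hle, hle⟩
  have h := norm_iteratedFDerivWithin_le_of_ckENorm_le hp.norm_le hi hx
  rw [max_eq_left (by linarith)] at h
  exact (h.trans (hL₁.trans hle)).trans
    (le_self_pow₀ (h1.trans (hL₁.trans hle)) (Nat.succ_ne_zero i))

theorem mainTheorem6 (d : ℕ) :
    ∃ β : ℝ, 0 < β ∧ ∀ k : ℕ, 2 ≤ k → ∃ C : ℝ, 0 < C ∧
      ∀ (L₁ L₂ : ℝ) (p q : EuclideanSpace ℝ (Fin d) → ℝ), 0 < L₂ →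
        IsRegularDensity k L₁ L₂ p → IsRegularDensity k L₁ L₂ q →
        Set.MapsTo (knotheRosenblatt p q) (unitCube d) (unitCube d) ∧
        ∃ f : WithLp 2 (EuclideanSpace ℝ (Fin d) × ℝ) → EuclideanSpace ℝ (Fin d),
          IsStraightLineVelocity (knotheRosenblatt p q) f ∧
          (∀ g : WithLp 2 (EuclideanSpace ℝ (Fin d) × ℝ) → EuclideanSpace ℝ (Fin d),
            IsStraightLineVelocity (knotheRosenblatt p q) g →
              Set.EqOn g f (unitCylinder d)) ∧
          ContDiffOn ℝ k f (unitCylinder d) ∧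
          ckENorm k (unitCylinder d) f ≤
            ENNReal.ofReal (C * (L₁ / L₂) ^ (β * (k : ℝ) ^ (d + 3))) := by
  -- `b` collects coefficients so that the base of the geometric bound for `f` is at most `Q^(b
  -- (k+1)^2)`; order `n` then raises it to `n + 1 ≤ 2 (k + 1)`, whence `β = 2 b`.
  set b : ℕ := 9 * (59 + 20 * d) + 69 + 2 * ((39 + 20 * d) * d) with hb
  refine ⟨2 * b, by positivity, fun k hk => ?_⟩
  obtain ⟨k, rfl⟩ : ∃ m, k = m + 1 := ⟨k - 1, by omega⟩
  set c : ℝ := 2 * ((d : ℝ) + 1) * (k + 1).factorial with hc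
  have hfac : (1 : ℝ) ≤ (k + 1).factorial := by exact_mod_cast Nat.factorial_pos (k + 1)
  have hd1 : (1 : ℝ) ≤ 2 * ((d : ℝ) + 1) := by
    have : (0 : ℝ) ≤ d := Nat.cast_nonneg d
    linarith
  have hc1 : 1 ≤ c := one_le_mul_of_one_le_of_one_le hd1 hfac
  -- The part of `Q^(2 b (k+1)^3)` that does not involve `L₁ / L₂`.
  refine ⟨c ^ (2 * b * (k + 1) ^ 3), by positivity, fun L₁ L₂ p q hL₂ hp hq => ?_⟩
  obtain ⟨-, hL₂1, hL₁1⟩ := hp.le_one_le hL₂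
  have hΛ : 1 ≤ L₁ / L₂ := by rw [one_le_div hL₂]; linarith
  have hpb := hp.isBoundedDensity hL₂ hc1
  have hqb := hq.isBoundedDensity hL₂ hc1
  set Q : ℝ := c * (L₁ / L₂) with hQdef
  have hcQ : c ≤ Q := le_mul_of_one_le_right (by linarith) hΛ
  have h : IsLargeConst (k + 1) d Q :=
    ⟨(le_mul_of_one_le_right (by linarith) hfac).trans hcQ,
      (le_mul_of_one_le_left (by linarith) hd1).trans hcQ⟩
  have htri := hpb.isTriangularMap_knotheRosenblatt h (by omega) hqb
  refine ⟨htri.mapsTo (inv_nonneg.2 (pow_nonneg h.nonneg _)), ?_⟩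
  obtain ⟨f, hf, huniq, hfb⟩ :=
    exists_velocity_of_isTriangularMap h (hpb.geom_knotheRosenblatt h hqb) htri
  refine ⟨f, hf, huniq, hfb.contDiffOn, ckENorm_le_ofReal fun n hn x hx => ?_⟩
  -- The argument yields exponent `3`; as `L₁ / L₂ ≥ 1`, enlarging it to `d + 3` only weakens the
  -- bound.
  have hpow : (L₁ / L₂) ^ (2 * b * (k + 1) ^ 3)
      ≤ (L₁ / L₂) ^ ((2 * b : ℝ) * ((k + 1 : ℕ) : ℝ) ^ (d + 3)) := by
    rw [← Real.rpow_natCast]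
    refine Real.rpow_le_rpow_of_exponent_le hΛ ?_
    have hk1 : (1 : ℝ) ≤ ((k + 1 : ℕ) : ℝ) := by exact_mod_cast Nat.succ_pos k
    have := pow_le_pow_right₀ hk1 (show 3 ≤ d + 3 by omega)
    push_cast at this ⊢
    gcongr
  refine le_trans ?_ (mul_le_mul_of_nonneg_left hpow (by positivity))
  rw [← mul_pow, ← hQdef]
  refine (hfb.bound n hn x hx).trans ?_
  rw [← pow_mul]
  refine h.pow_le ?_
  set A := 59 + 20 * d
  set B := (39 + 20 * d) * d with hB
  have hB' : (19 + (19 + 20 * d) + 1) * d = B := by rw [hB]; ring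
  rw [hB']
  calc _ ≤ (b * (k + 1) ^ 2) * (2 * (k + 1)) := by
        refine Nat.mul_le_mul ?_ (by omega)
        rw [hb]
        have h1 : 1 ≤ k + 1 := by omega
        have h2 : k + 1 ≤ (k + 1) ^ 2 := Nat.le_self_pow two_ne_zero _
        have h3 : A * (k + 1) ≤ A * (k + 1) ^ 2 := Nat.mul_le_mul_left _ h2
        have h4 : B * (k + 1) ≤ B * (k + 1) ^ 2 := Nat.mul_le_mul_left _ h2
        have h5 : A * (k + 1) + 5 + 2 * ((2 + (2 + B) + 4 * (A * (k + 1) + 7)) * (k + 1))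
          = A * (k + 1) + 5 + 64 * (k + 1) + 2 * (B * (k + 1)) + 8 * (A * (k + 1) ^ 2) := by ring
        have h6 : (9 * A + 69 + 2 * B) * (k + 1) ^ 2
          = 9 * (A * (k + 1) ^ 2) + 69 * (k + 1) ^ 2 + 2 * (B * (k + 1) ^ 2) := by ring
        rw [h5, h6]
        omega
    _ = _ := by ring
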